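/- For $\alpha>0$ and $\beta\in\mathbb R$ let $T_{\alpha,\beta}:\mathbb R\to\mathbb R$ be given by $T_{\alpha,\beta}(x)=\frac{\alpha}{2}\left(\frac{x+\beta}{\alpha}-\frac{\alpha}{x-\beta}\right)$ for $x\neq\beta$ and $T_{\alpha,\beta}(\beta)=\beta$, and let $\mu_{\alpha,\beta}$ be the probability measure on $\mathbb R$ with density $\frac{\alpha}{\pi}\,\frac{1}{\alpha^2+(t-\beta)^2}$. A sequence of natural numbers $(k_n)_{n\ge 0}$ is called $L^p$-good universal if for every probability space $(X,\mathcal A,\mu)$, every measurable, $\mu$-preserving map $T:X\to X$ and every $g\in L^p(X,\mathcal A,\mu)$ the limit $\lim_{N\to\infty}\frac1N\sum_{n=0}^{N-1}g(T^{k_n}x)$ exists for $\mu$-almost every $x$. It is called Hartman uniformly distributed if it is uniformly distributed among the residue classes modulo $m$ for every integer $m>1$, and if for every irrational $a$ the sequence $(k_na)_n$ is uniformly distributed modulo one. Theorem. Let $(k_n)_{n\ge0}$ be $L^p$-good universal for some $p\in[1,\infty]$ and Hartman uniformly distributed; if $p=\infty$, suppose also that the terms $k_n$ are pairwise distinct.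 Let $k\ge0$ be an integer, $\alpha>0$ and $\beta\in\mathbb R$, and let $\zeta^{(k)}$ be the $k$-th derivative of the Riemann zeta function. Then the following two statements are equivalent. (i) For every integer $l\ge1$ the integral on the right below is finite, and for $\mu_{\alpha,\beta}$-almost every $x\in\mathbb R$ $$\lim_{N\to\infty}\frac1N\sum_{n=0}^{N-1}\left|\zeta^{(k)}\left(\tfrac12+iT_{\alpha,\beta}^{k_n}(x)\right)\right|^{2l}=\frac{\alpha}{\pi}\int_{\mathbb R}\frac{\left|\zeta^{(k)}\left(\tfrac12+i\tau\right)\right|^{2l}}{\alpha^2+(\tau-\beta)^2}\,d\tau .$$ (ii) The Lindelöf Hypothesis: for every $\varepsilon>0$, $|\zeta(\tfrac12+it)|=O(|t|^{\varepsilon})$ as $|t|\to\infty$. -/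

import Mathlib

open MeasureTheory Filter Topology
open scoped ENNReal

noncomputable section

/-- The generalized Boole transformation `T_{α,β}` of the real line. -/
def booleMap (α β x : ℝ) : ℝ :=
  if x = β then β else α / 2 * ((x + β) / α - α / (x - β))

/-- The probability measure `μ_{α,β}`, with density `(α / π) / (α ^ 2 + (t - β) ^ 2)`
for `α > 0`: the Cauchy distribution with location `β` and scale `α`. -/
def booleMeasure (α β : ℝ) : Measure ℝ :=
  ProbabilityTheory.cauchyMeasure β α.toNNReal

/-- The sequence `k` (listed from index `0`) is `L^p`-good universal: for every probability space
`X`, every measure preserving `T : X → X` and every `g ∈ L^p`, the averages of `g` along the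
iterates `T ^ (k n)` converge almost everywhere. -/
def IsLpGoodUniversal (p : ℝ≥0∞) (k : ℕ → ℕ) : Prop :=
  ∀ (X : Type) [MeasurableSpace X] (μ : Measure X) [IsProbabilityMeasure μ] (T : X → X),
    MeasurePreserving T μ μ → ∀ g : X → ℂ, MemLp g p μ →
      ∀ᵐ x ∂μ, ∃ c : ℂ,
        Tendsto (fun N : ℕ => (∑ n ∈ Finset.range N, g (T^[k n] x)) / (N : ℂ)) atTop (𝓝 c)

open Classical in
/-- The real sequence `u` is uniformly distributed modulo one: for every interval `I` contained in
`[0, 1)`, the fractional parts of `u` visit `I` with asymptotic frequency the length of `I`. -/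
def UniformlyDistributedModOne (u : ℕ → ℝ) : Prop :=
  ∀ I : Set ℝ, I.OrdConnected → I ⊆ Set.Ico 0 1 →
    Tendsto (fun N : ℕ => (((Finset.range N).filter fun n => Int.fract (u n) ∈ I).card : ℝ) / N)
      atTop (𝓝 (volume.real I))

/-- The sequence `k` is uniformly distributed on the integers: for each `m > 1` it is uniformly
distributed among the residue classes modulo `m`. -/
def UniformlyDistributedOnInt (k : ℕ → ℕ) : Prop :=
  ∀ m : ℕ, 1 < m → ∀ r : ℕ,
    Tendsto (fun N : ℕ => (((Finset.range N).filter fun n => k n ≡ r [MOD m]).card : ℝ) / N)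
      atTop (𝓝 (1 / (m : ℝ)))

/-- Hartman uniform distribution (on the integers) of a sequence of natural numbers. -/
def HartmanUniformlyDistributed (k : ℕ → ℕ) : Prop :=
  UniformlyDistributedOnInt k ∧
    ∀ a : ℝ, Irrational a → UniformlyDistributedModOne fun n => (k n : ℝ) * a

/-- The Lindelöf Hypothesis: for every `ε > 0`, `ζ(1/2 + it) = O(|t| ^ ε)` as `|t| → ∞`. -/
def LindelofHypothesis : Prop :=
  ∀ ε : ℝ, 0 < ε →
    (fun t : ℝ => riemannZeta (1 / 2 + Complex.I * t))
      =O[Bornology.cobounded ℝ] fun t : ℝ => |t| ^ ε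

/-- The absolute value `|ζ^{(k)}(1/2 + it)|` of the `k`-th derivative on the critical line. -/
def absZetaDeriv (k : ℕ) (t : ℝ) : ℝ :=
  ‖iteratedDeriv k riemannZeta (1 / 2 + Complex.I * t)‖

end

/-! The implication from moments to Lindelöf uses the finiteness of the integrals. The next
derivative of zeta grows at most linearly on the critical line, so a large value of `|ζ^{(k)}|` at
height `t` persists on an interval of length about `1 / (1 + |t|)`. The finite `2l`-th moment then
bounds its `2l`-th power by a multiple of `(1 + |t|) ^ 3`, and large `l` makes the exponent `3 /
(2l)` small (`exists_le_rpow_of_integrable`). The order of the derivative is lowered to `0` by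
integrating horizontally from the line `Re s = 2`, with the three lines theorem controlling the path
(`exists_norm_iteratedDeriv_riemannZeta₀_le_of_succ`).

Conversely, under Lindelöf, convexity and Cauchy estimates give the same slow growth for every
derivative. The substitution `x = β - α cot (π y)` conjugates the Boole map to the doubling map of
the circle and the Cauchy law to Lebesgue measure, by the duplication formula for the cotangent. In
this coordinate `|ζ^{(k)}| ^ (2l)` lies in `L^p` for every finite `p`, so good universality yields a
pointwise limit. The limit is the mean because the averages converge to it in `L²`: doubling sends
nonconstant characters to distinct characters, and equidistribution modulo large integers forbids
any value of the sequence a positive frequency (`UnitAddCircle.ae_tendsto_average`).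

For `p = ∞` the function must be truncated. The remainder is dominated by a monotone singularity at
each end of `(0, 1]`. Correlations of such functions under doubling decay geometrically, so distinct
times give linear variance and averages of the remainder are eventually at most about twice their
mean, which tends to `0` with the truncation height. -/

/-! ### Functions of polynomial growth in vertical strips -/

theorem one_add_abs_rpow_le_mul (x y : ℝ) {A : ℝ} (hA : 0 ≤ A) :
    (1 + |x|) ^ A ≤ (1 + |y|) ^ A * (1 + |x - y|) ^ A := by
  rw [← Real.mul_rpow (by positivity) (by positivity)]
  refine Real.rpow_le_rpow (by positivity) ?_ hA
  have : |x| ≤ |y| + |x - y| := by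
    calc |x| = |y + (x - y)| := by ring_nf
      _ ≤ _ := abs_add_le _ _
  nlinarith [abs_nonneg y, abs_nonneg (x - y)]

/-- Since `1 + |x| ≤ exp |x|`, the exponent is at most `A|x| - x² ≤ A²`. This lets a Gaussian absorb
polynomial growth. -/
theorem one_add_abs_rpow_mul_exp_le (x : ℝ) {A : ℝ} (hA : 0 ≤ A) :
    (1 + |x|) ^ A * Real.exp (-x ^ 2) ≤ Real.exp (A ^ 2) := by
  have h1 : (1 + |x|) ^ A ≤ Real.exp (A * |x|) := by
    rw [mul_comm, Real.exp_mul]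
    refine Real.rpow_le_rpow (by positivity) ?_ hA
    linarith [Real.add_one_le_exp |x|]
  calc _ ≤ Real.exp (A * |x|) * Real.exp (-x ^ 2) := by gcongr
    _ = Real.exp (A * |x| - x ^ 2) := by rw [← Real.exp_add]; ring_nf
    _ ≤ _ := by
      apply Real.exp_le_exp.2
      rw [← sq_abs x]
      nlinarith [sq_nonneg (A - |x|), sq_nonneg A, sq_nonneg |x|]

/-- Cauchy estimates in a vertical strip for functions of polynomial growth. -/
theorem norm_iteratedDeriv_le_of_strip {f : ℂ → ℂ} (hf : Differentiable ℂ f) {a b A r C : ℝ}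
    (hA : 0 ≤ A) (hr : 0 < r) (hr1 : r ≤ 1)
    (h : ∀ s : ℂ, a ≤ s.re → s.re ≤ b → ‖f s‖ ≤ C * (1 + |s.im|) ^ A) (k : ℕ) (s : ℂ)
    (hs : a + r ≤ s.re) (hs' : s.re ≤ b - r) :
    ‖iteratedDeriv k f s‖ ≤ k.factorial * (C * 2 ^ A) / r ^ k * (1 + |s.im|) ^ A := by
  have hC : 0 ≤ C := by
    have := (norm_nonneg _).trans (h s (by linarith) (by linarith))
    by_contra! hC
    have h2 : 0 < (1 + |s.im|) ^ A := by positivity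
    nlinarith
  have := Complex.norm_iteratedDeriv_le_of_forall_mem_sphere_norm_le (f := f) (c := s) (R := r)
    (C := C * 2 ^ A * (1 + |s.im|) ^ A) k hr hf.diffContOnCl ?_
  · refine this.trans_eq ?_
    ring
  intro z hz
  have hz' : ‖z - s‖ = r := by simpa [dist_eq_norm] using hz
  have hre := (Complex.abs_re_le_norm (z - s)).trans hz'.le
  have him := (Complex.abs_im_le_norm (z - s)).trans hz'.le
  rw [Complex.sub_re, abs_le] at hre
  rw [Complex.sub_im] at him
  refine (h z (by linarith [hre.1]) (by linarith [hre.2])).trans ?_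
  rw [mul_assoc]
  gcongr
  rw [mul_comm]
  -- The factor `2 ^ A` is the cost of moving the weight from `z` to the centre `s`, at distance `r
  -- ≤ 1`.
  refine (one_add_abs_rpow_le_mul z.im s.im hA).trans ?_
  gcongr
  linarith

/-- Hadamard's three lines theorem for functions of polynomial growth. -/
theorem exists_norm_le_interp_of_strip {f : ℂ → ℂ} (hf : Differentiable ℂ f)
    {l u A₀ A B C₀ C₁ C₂ : ℝ} (hlu : l < u) (hA₀ : 0 ≤ A₀) (hA : 0 ≤ A) (hB : 0 ≤ B)
    (h₀ : ∀ s : ℂ, l ≤ s.re → s.re ≤ u → ‖f s‖ ≤ C₀ * (1 + |s.im|) ^ A₀)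
    (h₁ : ∀ s : ℂ, s.re = l → ‖f s‖ ≤ C₁ * (1 + |s.im|) ^ A)
    (h₂ : ∀ s : ℂ, s.re = u → ‖f s‖ ≤ C₂ * (1 + |s.im|) ^ B) :
    ∃ C : ℝ, ∀ s : ℂ, l ≤ s.re → s.re ≤ u → ‖f s‖ ≤ C * (1 + |s.im|) ^
      ((1 - (s.re - l) / (u - l)) * A + (s.re - l) / (u - l) * B) := by
  set D : ℝ := Real.exp (l ^ 2 + u ^ 2) with hD
  -- The factor `exp ((s - i t₀)²)` makes `f` bounded in the strip, as the three lines theorem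
  -- requires, and localises the boundary bounds at height `t₀`. At height `t₀` itself its modulus
  -- is at least `1`, so nothing is lost there.
  have hker : ∀ (c : ℝ) (s : ℂ) (t₀ E : ℝ), l ≤ s.re → s.re ≤ u → 0 ≤ E →
      ‖f s‖ ≤ c * (1 + |s.im|) ^ E →
      ‖f s * Complex.exp ((s - Complex.I * t₀) ^ 2)‖ ≤
        (|c| + 1) * D * Real.exp (E ^ 2) * (1 + |t₀|) ^ E := by
    intro c s t₀ E h1 h2 hE h
    have hre : ((s - Complex.I * t₀) ^ 2).re = s.re ^ 2 - (s.im - t₀) ^ 2 := by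
      simp [pow_two]
    have hsq : s.re ^ 2 ≤ l ^ 2 + u ^ 2 := by
      rcases le_total 0 s.re with h0 | h0 <;> nlinarith [sq_nonneg l, sq_nonneg u]
    rw [norm_mul, Complex.norm_exp, hre]
    calc ‖f s‖ * Real.exp (s.re ^ 2 - (s.im - t₀) ^ 2)
        ≤ (|c| + 1) * ((1 + |t₀|) ^ E * (1 + |s.im - t₀|) ^ E) *
            (D * Real.exp (-(s.im - t₀) ^ 2)) := by
          gcongr
          · refine h.trans ?_
            gcongr
            · linarith [le_abs_self c]
            · exact one_add_abs_rpow_le_mul _ _ hE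
          · rw [hD, ← Real.exp_add]
            apply Real.exp_le_exp.2
            linarith
      _ = (|c| + 1) * D * (1 + |t₀|) ^ E *
            ((1 + |s.im - t₀|) ^ E * Real.exp (-(s.im - t₀) ^ 2)) := by ring
      _ ≤ (|c| + 1) * D * (1 + |t₀|) ^ E * Real.exp (E ^ 2) := by
          gcongr
          exact one_add_abs_rpow_mul_exp_le _ hE
      _ = _ := by ring
  have hD1 : 1 ≤ D := Real.one_le_exp (by positivity)
  set M₁ : ℝ := (|C₁| + 1) * D * Real.exp (A ^ 2) with hM₁
  set M₂ : ℝ := (|C₂| + 1) * D * Real.exp (B ^ 2) with hM₂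
  -- Constants at least `1` dominate their own powers with exponent in `[0, 1]`, which makes the
  -- final constant independent of `s`.
  have one_le_M : ∀ (c E : ℝ), 1 ≤ (|c| + 1) * D * Real.exp (E ^ 2) := by
    intro c E
    have h1 : 1 ≤ |c| + 1 := by linarith [abs_nonneg c]
    have h2 : 1 ≤ Real.exp (E ^ 2) := Real.one_le_exp (by positivity)
    exact one_le_mul_of_one_le_of_one_le (one_le_mul_of_one_le_of_one_le h1 hD1) h2
  have hM₁1 : 1 ≤ M₁ := one_le_M _ _
  have hM₂1 : 1 ≤ M₂ := one_le_M _ _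
  refine ⟨M₁ * M₂, fun s hs1 hs2 => ?_⟩
  set θ := (s.re - l) / (u - l) with hθ
  have hul : 0 < u - l := by linarith
  have hθ0 : 0 ≤ θ := div_nonneg (by linarith) hul.le
  have hθ1 : θ ≤ 1 := (div_le_one hul).2 (by linarith)
  set t₀ := s.im
  have key := Complex.HadamardThreeLines.norm_le_interp_of_mem_verticalClosedStrip'
    (f := fun z => f z * Complex.exp ((z - Complex.I * t₀) ^ 2)) (z := s)
    (a := M₁ * (1 + |t₀|) ^ A) (b := M₂ * (1 + |t₀|) ^ B) hlu ⟨hs1, hs2⟩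
    (by apply Differentiable.diffContOnCl; fun_prop)
    (by
      refine ⟨(|C₀| + 1) * D * Real.exp (A₀ ^ 2) * (1 + |t₀|) ^ A₀, ?_⟩
      rintro _ ⟨z, hz, rfl⟩
      exact hker C₀ z t₀ A₀ hz.1 hz.2 hA₀ (h₀ z hz.1 hz.2))
    (by
      intro z hz
      have hz : z.re = l := hz
      exact hker C₁ z t₀ A hz.ge (by linarith) hA (h₁ z hz))
    (by
      intro z hz
      have hz : z.re = u := hz
      exact hker C₂ z t₀ B (by linarith) hz.le hB (h₂ z hz))
  have hlow : ‖f s‖ ≤ ‖f s * Complex.exp ((s - Complex.I * t₀) ^ 2)‖ := by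
    have hre : ((s - Complex.I * t₀) ^ 2).re = s.re ^ 2 := by simp [pow_two, t₀]
    rw [norm_mul, Complex.norm_exp, hre]
    exact le_mul_of_one_le_right (norm_nonneg _) (Real.one_le_exp (by positivity))
  clear_value M₁ M₂
  refine hlow.trans (key.trans ?_)
  rw [← hθ, Real.mul_rpow (by positivity) (by positivity),
    Real.mul_rpow (by positivity) (by positivity), ← Real.rpow_mul (by positivity),
    ← Real.rpow_mul (by positivity), mul_comm _ A, mul_comm _ B,
    Real.rpow_add (by positivity)]
  have e1 : M₁ ^ (1 - θ) ≤ M₁ := by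
    simpa using Real.rpow_le_rpow_of_exponent_le hM₁1 (show 1 - θ ≤ 1 by linarith)
  have e2 : M₂ ^ θ ≤ M₂ := by
    simpa using Real.rpow_le_rpow_of_exponent_le hM₂1 hθ1
  calc M₁ ^ (1 - θ) * (1 + |t₀|) ^ (A * (1 - θ)) * (M₂ ^ θ * (1 + |t₀|) ^ (B * θ))
      ≤ M₁ * (1 + |t₀|) ^ (A * (1 - θ)) * (M₂ * (1 + |t₀|) ^ (B * θ)) := by gcongr
    _ = _ := by ring

/-! ### Growth of zeta without its polar part -/

theorem locallyIntegrableOn_indicator_fract :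
    LocallyIntegrableOn ((Set.Ioi (1 : ℝ)).indicator fun t => ((Int.fract t : ℝ) : ℂ)) (Set.Ioi 0) := by
  apply LocallyIntegrable.locallyIntegrableOn
  refine (locallyIntegrable_const (1 : ℂ)).mono ?_ ?_
  · exact (Measurable.indicator (by fun_prop) measurableSet_Ioi).aestronglyMeasurable
  · refine ae_of_all _ fun t => ?_
    by_cases ht : t ∈ Set.Ioi (1 : ℝ)
    · simpa [ht, abs_of_nonneg (Int.fract_nonneg t)] using (Int.fract_lt_one t).le
    · simp [ht]

/-- As a Mellin transform the integral is holomorphic in `s`, which permits analytic continuation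
below. -/
theorem mellin_indicator_fract (s : ℂ) :
    mellin ((Set.Ioi (1 : ℝ)).indicator fun t => ((Int.fract t : ℝ) : ℂ)) (-s) =
      ∫ t in Set.Ioi (1 : ℝ), ((Int.fract t : ℝ) : ℂ) * (t : ℂ) ^ (-(s + 1)) := by
  rw [mellin, ← integral_indicator measurableSet_Ioi, ← integral_indicator measurableSet_Ioi]
  congr 1
  ext t
  by_cases ht : 1 < t
  · have h0 : 0 < t := by linarith
    simp only [Set.mem_Ioi, h0, Set.indicator_of_mem, ht, smul_eq_mul]
    rw [mul_comm]
    ring_nf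
  · by_cases h0 : 0 < t <;> simp [ht, h0]

theorem integrableOn_fract_mul_cpow {s : ℂ} (hs : 0 < s.re) :
    IntegrableOn (fun t : ℝ => ((Int.fract t : ℝ) : ℂ) * (t : ℂ) ^ (-(s + 1))) (Set.Ioi 1) := by
  have h := integrableOn_Ioi_cpow_of_lt (a := -(s + 1)) (by simpa using hs) (zero_lt_one' ℝ)
  refine Integrable.mono h ?_ ?_
  · exact (Measurable.aestronglyMeasurable (by fun_prop)).mul h.aestronglyMeasurable
  · refine ae_of_all _ fun t => ?_
    rw [norm_mul]
    refine mul_le_of_le_one_left (norm_nonneg _) ?_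
    simpa [abs_of_nonneg (Int.fract_nonneg t)] using (Int.fract_lt_one t).le

/-- Abel summation gives `ζ(s) = s ∫ ⌊t⌋ t^{-s-1} dt`. With `⌊t⌋ = t - {t}` the first term
contributes `s / (s - 1)`, which is `1` plus the polar part. -/
theorem riemannZeta₀_eq_of_one_lt_re {s : ℂ} (hs : 1 < s.re) :
    riemannZeta₀ s =
      1 - s * ∫ t in Set.Ioi (1 : ℝ), ((Int.fract t : ℝ) : ℂ) * (t : ℂ) ^ (-(s + 1)) := by
  have hs1 : s ≠ 1 := by rintro rfl; simp at hs
  have hs0 : s - 1 ≠ 0 := sub_ne_zero.2 hs1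
  have h1 : riemannZeta s = s * ∫ t in Set.Ioi (1 : ℝ), (⌊t⌋₊ : ℂ) * (t : ℂ) ^ (-(s + 1)) := by
    have := LSeries_eq_mul_integral' 1 (zero_le_one' ℝ) hs (by
      simp only [Pi.one_apply, norm_one, Finset.sum_const, Nat.card_Icc, Real.rpow_one]
      simpa using Asymptotics.isBigO_refl _ _)
    rw [LSeries_one_eq_riemannZeta hs] at this
    simpa using this
  have h2 : ∫ t in Set.Ioi (1 : ℝ), (t : ℂ) ^ (-s) = (s - 1)⁻¹ := by
    rw [integral_Ioi_cpow_of_lt (by simpa using hs) zero_lt_one]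
    have : -s + 1 ≠ 0 := by intro h; apply hs0; linear_combination -h
    simp
    field_simp
    ring
  have h3 : ∫ t in Set.Ioi (1 : ℝ), (⌊t⌋₊ : ℂ) * (t : ℂ) ^ (-(s + 1)) =
      (s - 1)⁻¹ - ∫ t in Set.Ioi (1 : ℝ), ((Int.fract t : ℝ) : ℂ) * (t : ℂ) ^ (-(s + 1)) := by
    rw [← h2, ← integral_sub (integrableOn_Ioi_cpow_of_lt (by simpa using hs) zero_lt_one)
      (integrableOn_fract_mul_cpow (by linarith))]
    refine setIntegral_congr_fun measurableSet_Ioi fun t ht => ?_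
    have ht : 1 < t := ht
    have ht0 : (t : ℂ) ≠ 0 := by exact_mod_cast (by linarith : t ≠ 0)
    have hfl : (⌊t⌋₊ : ℂ) = t - Int.fract t := by
      have : (⌊t⌋₊ : ℝ) = t - Int.fract t := by
        rw [natCast_floor_eq_intCast_floor (by linarith), Int.self_sub_fract]
      exact_mod_cast this
    have hpow : (t : ℂ) ^ (-s) = t * (t : ℂ) ^ (-(s + 1)) := by
      rw [show -s = 1 + -(s + 1) by ring, Complex.cpow_add _ _ ht0, Complex.cpow_one]
    simp only [hfl, hpow]
    ring
  have h4 := riemannZeta_eq_inv_sub_add hs1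
  rw [h1, h3] at h4
  rw [← sub_eq_iff_eq_add'] at h4
  rw [← h4]
  field_simp
  ring

/-- Both sides are holomorphic for `Re s > 0` and agree near `s = 2`, so the identity theorem
applies. -/
theorem riemannZeta₀_eq {s : ℂ} (hs : 0 < s.re) :
    riemannZeta₀ s =
      1 - s * ∫ t in Set.Ioi (1 : ℝ), ((Int.fract t : ℝ) : ℂ) * (t : ℂ) ^ (-(s + 1)) := by
  set U : Set ℂ := {z | 0 < z.re} with hU
  have hUo : IsOpen U := isOpen_lt continuous_const Complex.continuous_re
  set F : ℂ → ℂ := fun s =>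
    1 - s * mellin ((Set.Ioi (1 : ℝ)).indicator fun t => ((Int.fract t : ℝ) : ℂ)) (-s) with hF
  have hdF : DifferentiableOn ℂ F U := by
    intro z hz
    have hz : 0 < z.re := hz
    have hm : DifferentiableAt ℂ
        (mellin ((Set.Ioi (1 : ℝ)).indicator fun t => ((Int.fract t : ℝ) : ℂ))) (-z) := by
      -- The fractional part is bounded at infinity, whence `a = 0`. The indicator vanishes near
      -- `0`, so any `b` below `Re (-z)` would do.
      refine mellin_differentiableAt_of_isBigO_rpow (a := 0) (b := -z.re - 1)
        locallyIntegrableOn_indicator_fract ?_ (by simpa using hz) ?_ (by simp)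
      · refine Asymptotics.IsBigO.of_bound 1 (eventually_atTop.2 ⟨2, fun t ht => ?_⟩)
        have : t ∈ Set.Ioi (1 : ℝ) := by simp; linarith
        simpa [this, abs_of_nonneg (Int.fract_nonneg t)] using (Int.fract_lt_one t).le
      · refine Asymptotics.IsBigO.of_bound 1 ?_
        filter_upwards [Ioo_mem_nhdsGT (zero_lt_one' ℝ)] with t ht
        have : t ∉ Set.Ioi (1 : ℝ) := by simpa using ht.2.le
        simp [this]
    apply DifferentiableAt.differentiableWithinAt
    exact (differentiableAt_const _).sub (differentiableAt_id.mul
      (hm.comp z differentiableAt_id.neg))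
  have hpre : IsPreconnected U := (convex_halfSpace_re_gt 0).isPreconnected
  have heq := AnalyticOnNhd.eqOn_of_preconnected_of_eventuallyEq (𝕜 := ℂ) (f := riemannZeta₀)
    (g := F) (U := U) (differentiable_riemannZeta₀.differentiableOn.analyticOnNhd hUo)
    (hdF.analyticOnNhd hUo) hpre (z₀ := 2) (by simp [hU]) ?_
  · rw [heq hs, hF]
    simp only [mellin_indicator_fract]
  · have : {z : ℂ | 1 < z.re} ∈ 𝓝 (2 : ℂ) :=
      (isOpen_lt continuous_const Complex.continuous_re).mem_nhds (by simp)
    filter_upwards [this] with z hz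
    rw [riemannZeta₀_eq_of_one_lt_re hz, hF]
    simp only [mellin_indicator_fract]

theorem norm_riemannZeta₀_le {s : ℂ} (hs : 0 < s.re) :
    ‖riemannZeta₀ s‖ ≤ 1 + ‖s‖ / s.re := by
  rw [riemannZeta₀_eq hs]
  refine (norm_sub_le _ _).trans ?_
  rw [norm_one, norm_mul, div_eq_mul_inv]
  gcongr
  have h1 : ∫ t in Set.Ioi (1 : ℝ), t ^ (-(s.re + 1)) = s.re⁻¹ := by
    rw [integral_Ioi_rpow_of_lt (by linarith) zero_lt_one]
    simp
  rw [← h1]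
  refine norm_integral_le_of_norm_le
    (integrableOn_Ioi_rpow_of_lt (by linarith) zero_lt_one) ?_
  filter_upwards [ae_restrict_mem measurableSet_Ioi] with t ht
  have ht : 0 < t := zero_lt_one.trans ht
  rw [norm_mul, Complex.norm_cpow_eq_rpow_re_of_pos ht]
  refine (mul_le_of_le_one_left (by positivity) ?_).trans_eq (by simp)
  simpa [abs_of_nonneg (Int.fract_nonneg t)] using (Int.fract_lt_one t).le

theorem exists_norm_iteratedDeriv_riemannZeta₀_le (k : ℕ) :
    ∃ C : ℝ, ∀ s : ℂ, 1 / 4 ≤ s.re → s.re ≤ 3 →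
      ‖iteratedDeriv k riemannZeta₀ s‖ ≤ C * (1 + |s.im|) ^ (1 : ℝ) := by
  -- For `1/8 ≤ Re z ≤ 4` the bound `1 + ‖z‖ / Re z` is at most `1 + 8 (4 + |Im z|)`, whence `33`.
  refine ⟨_, fun s h1 h2 => norm_iteratedDeriv_le_of_strip (a := 1 / 8) (b := 4) (r := 1 / 8)
    (C := 33) differentiable_riemannZeta₀ zero_le_one (by norm_num) (by norm_num) ?_ k s
    (by linarith) (by linarith)⟩
  intro z h1 h2
  refine (norm_riemannZeta₀_le (by linarith)).trans ?_
  have h3 : ‖z‖ ≤ 4 + |z.im| := by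
    refine (Complex.norm_le_abs_re_add_abs_im z).trans ?_
    rw [abs_of_nonneg (by linarith : 0 ≤ z.re)]
    linarith
  have h4 : ‖z‖ / z.re ≤ (4 + |z.im|) / (1 / 8) := by gcongr
  rw [Real.rpow_one]
  linarith [abs_nonneg z.im]

/-- The Dirichlet series converges absolutely, uniformly for `Re z ≥ 3/2`, so Cauchy estimates of
radius `1/2` lose nothing in `t`. The line `Re s = 2` serves as the base of the horizontal
integration. -/
theorem exists_norm_iteratedDeriv_riemannZeta₀_le_of_re_eq_two (k : ℕ) :
    ∃ C : ℝ, ∀ s : ℂ, s.re = 2 → ‖iteratedDeriv k riemannZeta₀ s‖ ≤ C := by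
  have hb : ∀ z : ℂ, 3 / 2 ≤ z.re → z.re ≤ 5 / 2 → ‖riemannZeta₀ z‖ ≤
      ((∑' n : ℕ, 1 / ((n : ℝ) + 1) ^ (3 / 2 : ℝ)) + 2) * (1 + |z.im|) ^ (0 : ℝ) := by
    intro z h1 h2
    rw [Real.rpow_zero, mul_one]
    have hz1 : z ≠ 1 := by rintro rfl; norm_num at h1
    have h3 := riemannZeta_eq_inv_sub_add hz1
    rw [← sub_eq_iff_eq_add'] at h3
    rw [← h3]
    refine (norm_sub_le _ _).trans (add_le_add ?_ ?_)
    · rw [zeta_eq_tsum_one_div_nat_add_one_cpow (by linarith)]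
      have hsum : Summable fun n : ℕ => 1 / ((n : ℝ) + 1) ^ (3 / 2 : ℝ) := by
        have := (summable_nat_add_iff 1).2
          (Real.summable_one_div_nat_rpow.2 (by norm_num : (1 : ℝ) < 3 / 2))
        simpa using this
      refine tsum_of_norm_bounded hsum.hasSum fun n => ?_
      rw [norm_div, norm_one]
      have : ((n : ℂ) + 1) = ((n + 1 : ℝ) : ℂ) := by push_cast; ring
      rw [this, Complex.norm_cpow_eq_rpow_re_of_pos (by positivity)]
      gcongr
      linarith
    · rw [norm_inv]
      rw [show (2 : ℝ) = (1 / 2)⁻¹ by norm_num]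
      gcongr
      refine le_trans ?_ (Complex.abs_re_le_norm _)
      rw [Complex.sub_re, Complex.one_re, le_abs]
      left; linarith
  refine ⟨k.factorial * (((∑' n : ℕ, 1 / ((n : ℝ) + 1) ^ (3 / 2 : ℝ)) + 2) * 2 ^ (0 : ℝ)) /
    (1 / 2) ^ k, fun s hs => ?_⟩
  have := norm_iteratedDeriv_le_of_strip (r := 1 / 2) differentiable_riemannZeta₀ le_rfl
    (by norm_num) (by norm_num) hb k s (by linarith) (by linarith)
  simpa only [Real.rpow_zero, mul_one] using this

theorem differentiable_iteratedDeriv_riemannZeta₀ (k : ℕ) :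
    Differentiable ℂ (iteratedDeriv k riemannZeta₀) :=
  (differentiable_riemannZeta₀.contDiff (n := ⊤)).differentiable_iteratedDeriv k
    (by exact_mod_cast WithTop.coe_lt_top _)

theorem iteratedDeriv_riemannZeta_eq (k : ℕ) {s : ℂ} (hs : s ≠ 1) :
    iteratedDeriv k riemannZeta s =
      iteratedDeriv k (fun z => (z - 1)⁻¹) s + iteratedDeriv k riemannZeta₀ s := by
  have h : riemannZeta =ᶠ[𝓝 s] (fun z => (z - 1)⁻¹) + riemannZeta₀ := by
    filter_upwards [isOpen_ne.mem_nhds hs] with z hz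
    exact riemannZeta_eq_inv_sub_add hz
  rw [h.iteratedDeriv_eq k, iteratedDeriv_add]
  · exact (contDiffAt_id.sub contDiffAt_const).inv (sub_ne_zero.2 hs)
  · exact differentiable_riemannZeta₀.contDiff.contDiffAt

/-- Circles of radius `1/4` about points of the critical line stay at distance at least `1/4` from
the pole. -/
theorem norm_iteratedDeriv_inv_sub_one_le (k : ℕ) {s : ℂ} (hs : s.re = 1 / 2) :
    ‖iteratedDeriv k (fun z => (z - 1)⁻¹) s‖ ≤ k.factorial * 4 / (1 / 4) ^ k := by
  have hre : ∀ z ∈ Metric.closedBall s (1 / 4), 1 / 4 ≤ ‖z - 1‖ := by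
    intro z hz
    have hz' : ‖z - s‖ ≤ 1 / 4 := by simpa [dist_eq_norm] using hz
    have h1 := (Complex.abs_re_le_norm (z - s)).trans hz'
    rw [Complex.sub_re, abs_le] at h1
    refine le_trans ?_ (Complex.abs_re_le_norm _)
    rw [Complex.sub_re, Complex.one_re, le_abs]
    right; linarith [h1.2]
  have hne : ∀ z ∈ Metric.closedBall s (1 / 4), z - 1 ≠ 0 := by
    intro z hz h0
    have := hre z hz
    rw [h0] at this
    norm_num at this
  refine Complex.norm_iteratedDeriv_le_of_forall_mem_sphere_norm_le k (by norm_num) ?_ ?_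
  · refine DifferentiableOn.diffContOnCl_ball (U := Metric.closedBall s (1 / 4)) ?_ subset_rfl
    intro z hz
    exact DifferentiableAt.differentiableWithinAt (DifferentiableAt.inv (by fun_prop) (hne z hz))
  · intro z hz
    rw [norm_inv, show (4 : ℝ) = (1 / 4)⁻¹ by norm_num]
    gcongr
    exact hre z (Metric.sphere_subset_closedBall hz)

/-! ### Zeta and its derivatives on the critical line -/

theorem re_half_add_I_mul (t : ℝ) : (1 / 2 + Complex.I * t : ℂ).re = 1 / 2 := by simp

theorem im_half_add_I_mul (t : ℝ) : (1 / 2 + Complex.I * t : ℂ).im = t := by simp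

theorem half_add_I_mul_ne_one (t : ℝ) : (1 / 2 + Complex.I * t : ℂ) ≠ 1 := by
  intro h
  have := congrArg Complex.re h
  rw [re_half_add_I_mul] at this
  norm_num at this

theorem eq_half_add_I_mul {s : ℂ} (hs : s.re = 1 / 2) : s = 1 / 2 + Complex.I * s.im := by
  apply Complex.ext
  · rw [re_half_add_I_mul, hs]
  · rw [im_half_add_I_mul]

/-- The derivatives of the polar part are bounded on the line, so growth estimates pass freely
between zeta and the entire function `riemannZeta₀`. -/
theorem exists_abs_absZetaDeriv_sub_le (k : ℕ) :
    ∃ C : ℝ, 0 ≤ C ∧ ∀ t : ℝ,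
      |absZetaDeriv k t - ‖iteratedDeriv k riemannZeta₀ (1 / 2 + Complex.I * t)‖| ≤ C := by
  refine ⟨k.factorial * 4 / (1 / 4) ^ k, by positivity, fun t => ?_⟩
  refine (abs_norm_sub_norm_le _ _).trans ?_
  rw [iteratedDeriv_riemannZeta_eq k (half_add_I_mul_ne_one t), add_sub_cancel_right]
  exact norm_iteratedDeriv_inv_sub_one_le k (re_half_add_I_mul t)

theorem hasDerivAt_iteratedDeriv_riemannZeta (k : ℕ) (t : ℝ) :
    HasDerivAt (fun t : ℝ => iteratedDeriv k riemannZeta (1 / 2 + Complex.I * t))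
      (iteratedDeriv (k + 1) riemannZeta (1 / 2 + Complex.I * t) * Complex.I) t := by
  have hs := half_add_I_mul_ne_one t
  have han : AnalyticAt ℂ (iteratedDeriv k riemannZeta) (1 / 2 + Complex.I * t) := by
    rw [iteratedDeriv_eq_iterate]
    apply AnalyticAt.iterated_deriv
    apply DifferentiableOn.analyticAt (s := {1}ᶜ) _ (isOpen_compl_singleton.mem_nhds hs)
    exact fun z hz => (differentiableAt_riemannZeta hz).differentiableWithinAt
  have h1 := han.differentiableAt.hasDerivAt
  rw [← iteratedDeriv_succ] at h1
  have h2 : HasDerivAt (fun t : ℝ => (1 / 2 + Complex.I * t : ℂ)) Complex.I t := by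
    have := (Complex.ofRealCLM.hasDerivAt (x := t)).const_mul Complex.I
    simpa using this.const_add (1 / 2 : ℂ)
  exact h1.comp t h2

theorem continuous_absZetaDeriv (k : ℕ) : Continuous (absZetaDeriv k) := by
  refine Continuous.norm (continuous_iff_continuousAt.2 fun t => ?_)
  exact (hasDerivAt_iteratedDeriv_riemannZeta k t).continuousAt

theorem absZetaDeriv_nonneg (k : ℕ) (t : ℝ) : 0 ≤ absZetaDeriv k t := norm_nonneg _

/-- A continuous function which is `O(|t| ^ ε)` is bounded by a multiple of `(1 + |t|) ^ ε`. -/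
theorem exists_norm_le_of_isBigO_cobounded {f : ℝ → ℂ} (hf : Continuous f) {ε : ℝ} (hε : 0 < ε)
    (h : f =O[Bornology.cobounded ℝ] fun t : ℝ => |t| ^ ε) :
    ∃ C : ℝ, ∀ t, ‖f t‖ ≤ C * (1 + |t|) ^ ε := by
  obtain ⟨c, hc⟩ := h.bound
  rw [Metric.hasBasis_cobounded_compl_closedBall (0 : ℝ)
    |>.eventually_iff] at hc
  obtain ⟨R, -, hR⟩ := hc
  obtain ⟨B, hB⟩ := (isCompact_closedBall (0 : ℝ) R).exists_bound_of_continuousOn hf.continuousOn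
  refine ⟨|c| + |B|, fun t => ?_⟩
  have h1 : 1 ≤ (1 + |t|) ^ ε := Real.one_le_rpow (by linarith [abs_nonneg t]) hε.le
  by_cases ht : t ∈ Metric.closedBall (0 : ℝ) R
  · calc ‖f t‖ ≤ |B| := (hB t ht).trans (le_abs_self B)
      _ ≤ |B| * (1 + |t|) ^ ε := le_mul_of_one_le_right (abs_nonneg _) h1
      _ ≤ _ := by gcongr; linarith [abs_nonneg c]
  · have h2 := hR (show t ∈ (Metric.closedBall (0 : ℝ) R)ᶜ from ht)
    rw [Real.norm_of_nonneg (by positivity)] at h2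
    calc ‖f t‖ ≤ |c| * |t| ^ ε := h2.trans (by gcongr; exact le_abs_self c)
      _ ≤ (|c| + |B|) * (1 + |t|) ^ ε := by
        gcongr
        · linarith [abs_nonneg B]
        · linarith

/-- Lindelöf controls only the line, whereas a Cauchy estimate needs a neighbourhood. Interpolation
with the linear bounds on `Re s = 1/4` and `Re s = 3/4` provides a thin strip with exponent `ε`. -/
theorem exists_norm_iteratedDeriv_riemannZeta₀_le_of_lindelof (h : LindelofHypothesis)
    (k : ℕ) {ε : ℝ} (hε : 0 < ε) :
    ∃ C : ℝ, ∀ t : ℝ,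
      ‖iteratedDeriv k riemannZeta₀ (1 / 2 + Complex.I * t)‖ ≤ C * (1 + |t|) ^ ε := by
  wlog hε1 : ε ≤ 1 generalizing ε
  · obtain ⟨C, hC⟩ := this zero_lt_one le_rfl
    refine ⟨|C|, fun t => (hC t).trans ?_⟩
    calc C * (1 + |t|) ^ (1 : ℝ) ≤ |C| * (1 + |t|) ^ (1 : ℝ) := by
          gcongr; exact le_abs_self C
      _ ≤ _ := by
        gcongr
        · linarith [abs_nonneg t]
        · linarith
  set δ := ε / 2 with hδ
  have hδ0 : 0 < δ := by positivity
  obtain ⟨C₀, hC₀⟩ := exists_norm_iteratedDeriv_riemannZeta₀_le 0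
  simp only [iteratedDeriv_zero] at hC₀
  obtain ⟨C₁, hC₁⟩ := exists_norm_le_of_isBigO_cobounded
    (f := fun t : ℝ => riemannZeta (1 / 2 + Complex.I * t))
    (by
      refine continuous_iff_continuousAt.2 fun t => ?_
      simpa using (hasDerivAt_iteratedDeriv_riemannZeta 0 t).continuousAt) hδ0 (h δ hδ0)
  obtain ⟨D, hD0, hD⟩ := exists_abs_absZetaDeriv_sub_le 0
  have hmid : ∀ s : ℂ, s.re = 1 / 2 → ‖riemannZeta₀ s‖ ≤ (C₁ + D) * (1 + |s.im|) ^ δ := by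
    intro s hs
    have h1 := (abs_le.1 (hD s.im)).1
    have h2 := hC₁ s.im
    simp only [absZetaDeriv, iteratedDeriv_zero] at h1
    rw [← eq_half_add_I_mul hs] at h1 h2
    have h3 : D ≤ D * (1 + |s.im|) ^ δ :=
      le_mul_of_one_le_right hD0 (Real.one_le_rpow (by linarith [abs_nonneg s.im]) hδ0.le)
    nlinarith
  obtain ⟨C₂, hC₂⟩ := exists_norm_le_interp_of_strip differentiable_riemannZeta₀
    (l := 1 / 4) (u := 1 / 2) (A := 1) (B := δ) (by norm_num) zero_le_one zero_le_one hδ0.le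
    (fun s h1 h2 => hC₀ s h1 (by linarith))
    (fun s h1 => hC₀ s (by linarith) (by linarith)) hmid
  obtain ⟨C₃, hC₃⟩ := exists_norm_le_interp_of_strip differentiable_riemannZeta₀
    (l := 1 / 2) (u := 3 / 4) (A := δ) (B := 1) (by norm_num) zero_le_one hδ0.le zero_le_one
    (fun s h1 h2 => hC₀ s (by linarith) (by linarith)) hmid
    (fun s h1 => hC₀ s (by linarith) (by linarith))
  -- Within `r` of the line the linear bound has interpolation weight at most `4r = ε/2`; the bound
  -- on the line contributes at most `δ = ε/2`. The reduction to `ε ≤ 1` keeps the strip between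
  -- `1/4` and `3/4`.
  set r := ε / 8 with hr
  have hstrip : ∀ s : ℂ, 1 / 2 - r ≤ s.re → s.re ≤ 1 / 2 + r →
      ‖riemannZeta₀ s‖ ≤ (|C₂| + |C₃|) * (1 + |s.im|) ^ ε := by
    intro s h1 h2
    have hbase : 1 ≤ 1 + |s.im| := by linarith [abs_nonneg s.im]
    rcases le_total s.re (1 / 2) with h3 | h3
    · refine (hC₂ s (by linarith) h3).trans ?_
      refine (mul_le_mul_of_nonneg_right (le_abs_self C₂) (by positivity)).trans ?_
      gcongr
      · linarith [abs_nonneg C₃]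
      · have h4 : (s.re - 1 / 4) / (1 / 2 - 1 / 4) = 4 * s.re - 1 := by ring
        rw [h4]
        nlinarith
    · refine (hC₃ s h3 (by linarith)).trans ?_
      refine (mul_le_mul_of_nonneg_right (le_abs_self C₃) (by positivity)).trans ?_
      gcongr
      · linarith [abs_nonneg C₂]
      · have h4 : (s.re - 1 / 2) / (3 / 4 - 1 / 2) = 4 * s.re - 2 := by ring
        rw [h4]
        nlinarith
  refine ⟨k.factorial * ((|C₂| + |C₃|) * 2 ^ ε) / r ^ k, fun t => ?_⟩
  have := norm_iteratedDeriv_le_of_strip (r := r) differentiable_riemannZeta₀ hε.le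
    (by positivity) (by linarith) hstrip k (1 / 2 + Complex.I * t)
    (by rw [re_half_add_I_mul]; linarith) (by rw [re_half_add_I_mul]; linarith)
  rw [im_half_add_I_mul] at this
  exact this

theorem exists_absZetaDeriv_le_of_lindelof (h : LindelofHypothesis)
    (k : ℕ) {ε : ℝ} (hε : 0 < ε) :
    ∃ C : ℝ, 0 ≤ C ∧ ∀ t : ℝ, absZetaDeriv k t ≤ C * (1 + |t|) ^ ε := by
  obtain ⟨C, hC⟩ := exists_norm_iteratedDeriv_riemannZeta₀_le_of_lindelof h k hε
  obtain ⟨D, hD0, hD⟩ := exists_abs_absZetaDeriv_sub_le k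
  refine ⟨|C| + D, by positivity, fun t => ?_⟩
  have h1 : 1 ≤ (1 + |t|) ^ ε := Real.one_le_rpow (by linarith [abs_nonneg t]) hε.le
  have h2 := (abs_le.1 (hD t)).2
  have h3 := hC t
  nlinarith [le_abs_self C, abs_nonneg C]

theorem exists_absZetaDeriv_le_linear (k : ℕ) :
    ∃ C : ℝ, 0 ≤ C ∧ ∀ t : ℝ, absZetaDeriv k t ≤ C * (1 + |t|) := by
  obtain ⟨C, hC⟩ := exists_norm_iteratedDeriv_riemannZeta₀_le k
  obtain ⟨D, hD0, hD⟩ := exists_abs_absZetaDeriv_sub_le k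
  refine ⟨|C| + D, by positivity, fun t => ?_⟩
  have h2 := (abs_le.1 (hD t)).2
  have h3 := hC (1 / 2 + Complex.I * t) (by rw [re_half_add_I_mul]; norm_num)
    (by rw [re_half_add_I_mul]; norm_num)
  rw [im_half_add_I_mul, Real.rpow_one] at h3
  nlinarith [le_abs_self C, abs_nonneg C, abs_nonneg t]

/-- This is the mean value inequality with the linear bound for the next derivative. On `[t, t + 1]`
one has `1 + |y| ≤ 2 (1 + |t|)`, whence the constant `2C`, enlarged by `1` to ensure `B ≥ 1`. -/
theorem exists_absZetaDeriv_lipschitz (k : ℕ) :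
    ∃ B : ℝ, 1 ≤ B ∧ ∀ t x : ℝ, x ∈ Set.Icc t (t + 1) →
      absZetaDeriv k t - absZetaDeriv k x ≤ B * (1 + |t|) * (x - t) := by
  obtain ⟨C, hC0, hC⟩ := exists_absZetaDeriv_le_linear (k + 1)
  refine ⟨2 * C + 1, by linarith, fun t x hx => ?_⟩
  have h1 := Convex.norm_image_sub_le_of_norm_hasDerivWithin_le
    (s := Set.Icc t (t + 1)) (x := x) (y := t) (C := (2 * C + 1) * (1 + |t|))
    (fun y _ => (hasDerivAt_iteratedDeriv_riemannZeta k y).hasDerivWithinAt)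
    (fun y hy => by
      rw [norm_mul, Complex.norm_I, mul_one]
      refine (hC y).trans ?_
      have : |y| ≤ |t| + 1 := by
        rw [abs_le]
        constructor <;> linarith [hy.1, hy.2, le_abs_self t, neg_abs_le t]
      nlinarith [abs_nonneg t])
    (convex_Icc _ _) hx ⟨le_rfl, by linarith⟩
  rw [Real.norm_eq_abs, abs_sub_comm,
    abs_of_nonneg (sub_nonneg.2 hx.1)] at h1
  exact (norm_sub_norm_le _ _).trans h1

/-! ### From finite moments to the Lindelöf Hypothesis -/

/-- A function with slowly growing Lipschitz constants whose `2l`-th moments against the Cauchy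
density are all finite grows more slowly than every power. -/
theorem exists_le_rpow_of_integrable {G : ℝ → ℝ} {B α β : ℝ} (hα : 0 < α) (hB : 1 ≤ B)
    (hG0 : ∀ t, 0 ≤ G t)
    (hG : ∀ t x : ℝ, x ∈ Set.Icc t (t + 1) → G t - G x ≤ B * (1 + |t|) * (x - t))
    (hint : ∀ l : ℕ, 1 ≤ l → Integrable fun τ : ℝ => G τ ^ (2 * l) / (α ^ 2 + (τ - β) ^ 2))
    {ε : ℝ} (hε : 0 < ε) :
    ∃ C : ℝ, ∀ t, G t ≤ C * (1 + |t|) ^ ε := by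
  -- The bound will be `G t ^ (2l) ≪ (1 + |t|) ^ 3`: one power from the length of the interval used,
  -- two from the Cauchy density. Hence `3 / (2l) < ε` is required.
  obtain ⟨l, hl⟩ := exists_nat_gt (3 / (2 * ε))
  have hl0 : (0 : ℝ) < l := lt_trans (by positivity) hl
  have hl1 : 1 ≤ l := by exact_mod_cast hl0
  have hI := hint l hl1
  set I := ∫ τ : ℝ, G τ ^ (2 * l) / (α ^ 2 + (τ - β) ^ 2) with hIdef
  have hnn : ∀ τ : ℝ, 0 ≤ G τ ^ (2 * l) / (α ^ 2 + (τ - β) ^ 2) := fun τ =>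
    div_nonneg (pow_nonneg (hG0 τ) _) (by positivity)
  have hI0 : 0 ≤ I := integral_nonneg hnn
  set W := α ^ 2 + (2 + |β|) ^ 2 with hW
  have hW0 : 0 < W := by positivity
  set K := 2 ^ (2 * l) * (2 * B * W * I) with hK
  have hK0 : 0 ≤ K := by positivity
  refine ⟨(K + 1) ^ (1 / (2 * l) : ℝ), fun t => ?_⟩
  have hbase : 1 ≤ 1 + |t| := by linarith [abs_nonneg t]
  have hC1 : 1 ≤ (K + 1) ^ (1 / (2 * l) : ℝ) := Real.one_le_rpow (by linarith) (by positivity)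
  rcases le_total (G t) 1 with h1 | h1
  · exact h1.trans (one_le_mul_of_one_le_of_one_le hC1 (Real.one_le_rpow hbase hε.le))
  -- Over this length `G` drops by at most `1/2`, so it stays above `G t / 2` because `G t ≥ 1`.
  set h := 1 / (2 * B * (1 + |t|)) with hh
  have hh0 : 0 < h := by positivity
  have hh1 : h ≤ 1 := by
    rw [hh, div_le_one (by positivity)]
    nlinarith [abs_nonneg t]
  have hlow : ∀ x ∈ Set.Icc t (t + h),
      (G t / 2) ^ (2 * l) / (W * (1 + |t|) ^ 2) ≤ G x ^ (2 * l) / (α ^ 2 + (x - β) ^ 2) := by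
    intro x hx
    have h2 := hG t x ⟨hx.1, by linarith [hx.2]⟩
    have h3 : B * (1 + |t|) * (x - t) ≤ B * (1 + |t|) * h := by
      gcongr
      linarith [hx.2]
    have h4 : B * (1 + |t|) * h = 1 / 2 := by
      rw [hh]; field_simp
    have h5 : G t / 2 ≤ G x := by linarith
    have h6 : |x - β| ≤ (2 + |β|) * (1 + |t|) := by
      rw [abs_le]
      constructor <;> nlinarith [hx.1, hx.2, le_abs_self t, neg_abs_le t, le_abs_self β,
        neg_abs_le β, abs_nonneg t, abs_nonneg β, mul_nonneg (abs_nonneg t) (abs_nonneg β)]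
    have h7 : (x - β) ^ 2 ≤ (2 + |β|) ^ 2 * (1 + |t|) ^ 2 := by
      rw [← sq_abs, ← mul_pow]
      gcongr
    have h8 : α ^ 2 ≤ α ^ 2 * (1 + |t|) ^ 2 :=
      le_mul_of_one_le_right (by positivity) (one_le_pow₀ hbase)
    gcongr
    · exact pow_nonneg (hG0 x) _
    · linarith
  have hkey : h * ((G t / 2) ^ (2 * l) / (W * (1 + |t|) ^ 2)) ≤ I := by
    calc h * ((G t / 2) ^ (2 * l) / (W * (1 + |t|) ^ 2))
        = ∫ _ in Set.Icc t (t + h), (G t / 2) ^ (2 * l) / (W * (1 + |t|) ^ 2) := by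
          simp [hh0.le]
      _ ≤ ∫ x in Set.Icc t (t + h), G x ^ (2 * l) / (α ^ 2 + (x - β) ^ 2) :=
          setIntegral_mono_on (by simp) hI.integrableOn measurableSet_Icc hlow
      _ ≤ I := setIntegral_le_integral hI (ae_of_all _ hnn)
  have hpow : G t ^ (2 * l) ≤ (K + 1) * (1 + |t|) ^ 3 := by
    have e : h * ((G t / 2) ^ (2 * l) / (W * (1 + |t|) ^ 2)) =
        G t ^ (2 * l) / (2 ^ (2 * l) * (2 * B * W) * (1 + |t|) ^ 3) := by
      rw [hh, div_pow]; field_simp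
    rw [e, div_le_iff₀ (by positivity)] at hkey
    calc G t ^ (2 * l) ≤ K * (1 + |t|) ^ 3 := hkey.trans_eq (by rw [hK]; ring)
      _ ≤ _ := by gcongr; linarith
  have hroot : G t = (G t ^ (2 * l)) ^ (1 / (2 * l) : ℝ) := by
    rw [← Real.rpow_natCast, ← Real.rpow_mul (hG0 t)]
    push_cast
    rw [mul_one_div_cancel (by positivity), Real.rpow_one]
  rw [hroot]
  calc (G t ^ (2 * l)) ^ (1 / (2 * l) : ℝ)
      ≤ ((K + 1) * (1 + |t|) ^ 3) ^ (1 / (2 * l) : ℝ) := by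
        apply Real.rpow_le_rpow (pow_nonneg (hG0 t) _) hpow (by positivity)
    _ = (K + 1) ^ (1 / (2 * l) : ℝ) * (1 + |t|) ^ (3 * (1 / (2 * l)) : ℝ) := by
        rw [Real.mul_rpow (by positivity) (by positivity), ← Real.rpow_natCast (1 + |t|) 3,
          ← Real.rpow_mul (by positivity)]
        norm_num
    _ ≤ _ := by
        gcongr
        rw [div_lt_iff₀ (by positivity)] at hl
        rw [mul_one_div, div_le_iff₀ (by positivity)]
        nlinarith

/-- Interpolation between `Re s = 1/2` and `Re s = 2` gives the exponent `ε` for the higher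
derivative along the whole horizontal segment. The mean value inequality then starts from `2 + it`,
where the lower derivative is bounded. -/
theorem exists_norm_iteratedDeriv_riemannZeta₀_le_of_succ {k : ℕ} {ε : ℝ} (hε : 0 < ε)
    (h : ∃ C : ℝ, ∀ t : ℝ,
      ‖iteratedDeriv (k + 1) riemannZeta₀ (1 / 2 + Complex.I * t)‖ ≤ C * (1 + |t|) ^ ε) :
    ∃ C : ℝ, ∀ t : ℝ,
      ‖iteratedDeriv k riemannZeta₀ (1 / 2 + Complex.I * t)‖ ≤ C * (1 + |t|) ^ ε := by
  obtain ⟨C, hC⟩ := h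
  obtain ⟨C₀, hC₀⟩ := exists_norm_iteratedDeriv_riemannZeta₀_le (k + 1)
  obtain ⟨C₁, hC₁⟩ := exists_norm_iteratedDeriv_riemannZeta₀_le_of_re_eq_two (k + 1)
  obtain ⟨C₂, hC₂⟩ := exists_norm_iteratedDeriv_riemannZeta₀_le_of_re_eq_two k
  obtain ⟨D, hD⟩ := exists_norm_le_interp_of_strip
    (differentiable_iteratedDeriv_riemannZeta₀ (k + 1))
    (l := 1 / 2) (u := 2) (A := ε) (B := 0) (C₁ := C) (C₂ := C₁) (by norm_num) zero_le_one
    hε.le le_rfl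
    (fun s h1 h2 => hC₀ s (by linarith) (by linarith))
    (fun s hs => by
      have := hC s.im
      rwa [← eq_half_add_I_mul hs] at this)
    (fun s hs => by simpa using hC₁ s hs)
  refine ⟨|C₂| + |D| * 2, fun t => ?_⟩
  have hbase : 1 ≤ 1 + |t| := by linarith [abs_nonneg t]
  have hpow : 1 ≤ (1 + |t|) ^ ε := Real.one_le_rpow hbase hε.le
  have hconv : Convex ℝ {s : ℂ | s.re ∈ Set.Icc (1 / 2 : ℝ) 2 ∧ s.im = t} := by
    have e : {s : ℂ | s.re ∈ Set.Icc (1 / 2 : ℝ) 2 ∧ s.im = t} =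
        (Complex.reLm ⁻¹' Set.Icc (1 / 2 : ℝ) 2) ∩ (Complex.imLm ⁻¹' {t}) := rfl
    rw [e]
    exact ((convex_Icc _ _).linear_preimage _).inter ((convex_singleton _).linear_preimage _)
  have key := Convex.norm_image_sub_le_of_norm_deriv_le
    (f := iteratedDeriv k riemannZeta₀)
    (s := {s : ℂ | s.re ∈ Set.Icc (1 / 2 : ℝ) 2 ∧ s.im = t})
    (x := 2 + Complex.I * t) (y := 1 / 2 + Complex.I * t) (C := |D| * (1 + |t|) ^ ε)
    (fun z _ => differentiable_iteratedDeriv_riemannZeta₀ k z)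
    (fun z hz => by
      rw [← iteratedDeriv_succ]
      refine (hD z hz.1.1 hz.1.2).trans ?_
      rw [hz.2, mul_zero, add_zero]
      refine (mul_le_mul_of_nonneg_right (le_abs_self D) (by positivity)).trans ?_
      gcongr
      have : 0 ≤ (z.re - 1 / 2) / (2 - 1 / 2) := div_nonneg (by linarith [hz.1.1]) (by norm_num)
      nlinarith)
    hconv (by constructor <;> simp; norm_num) (by constructor <;> simp; norm_num)
  have h2 : ‖(1 / 2 + Complex.I * t : ℂ) - (2 + Complex.I * t)‖ ≤ 2 := by
    rw [show (1 / 2 + Complex.I * t : ℂ) - (2 + Complex.I * t) = ((-3 / 2 : ℝ) : ℂ) by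
      push_cast; ring, Complex.norm_real]
    norm_num [abs_le]
  have h3 := hC₂ (2 + Complex.I * t) (by simp)
  have h4 := norm_sub_norm_le (iteratedDeriv k riemannZeta₀ (1 / 2 + Complex.I * t))
    (iteratedDeriv k riemannZeta₀ (2 + Complex.I * t))
  have h5 : |D| * (1 + |t|) ^ ε * ‖(1 / 2 + Complex.I * t : ℂ) - (2 + Complex.I * t)‖ ≤
      |D| * (1 + |t|) ^ ε * 2 := by gcongr
  have h6 : |C₂| ≤ |C₂| * (1 + |t|) ^ ε := le_mul_of_one_le_right (abs_nonneg _) hpow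
  linarith [le_abs_self C₂]

theorem lindelofHypothesis_of_integrable {k : ℕ} {α β : ℝ} (hα : 0 < α)
    (hint : ∀ l : ℕ, 1 ≤ l →
      Integrable fun τ : ℝ => absZetaDeriv k τ ^ (2 * l) / (α ^ 2 + (τ - β) ^ 2)) :
    LindelofHypothesis := by
  intro ε hε
  obtain ⟨B, hB1, hB⟩ := exists_absZetaDeriv_lipschitz k
  obtain ⟨C, hC⟩ := exists_le_rpow_of_integrable hα hB1 (absZetaDeriv_nonneg k) hB hint hε
  obtain ⟨D, hD0, hD⟩ := exists_abs_absZetaDeriv_sub_le k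
  have hone : ∀ t : ℝ, 1 ≤ (1 + |t|) ^ ε := fun t =>
    Real.one_le_rpow (by linarith [abs_nonneg t]) hε.le
  have hk : ∃ C : ℝ, ∀ t : ℝ,
      ‖iteratedDeriv k riemannZeta₀ (1 / 2 + Complex.I * t)‖ ≤ C * (1 + |t|) ^ ε := by
    refine ⟨C + D, fun t => ?_⟩
    have h1 := (abs_le.1 (hD t)).1
    have h2 := hC t
    nlinarith [hone t]
  have h0 : ∃ C : ℝ, ∀ t : ℝ,
      ‖iteratedDeriv 0 riemannZeta₀ (1 / 2 + Complex.I * t)‖ ≤ C * (1 + |t|) ^ ε := by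
    clear hC hD hB hint
    induction k with
    | zero => exact hk
    | succ k ih => exact ih (exists_norm_iteratedDeriv_riemannZeta₀_le_of_succ hε hk)
  obtain ⟨E, hE⟩ := h0
  obtain ⟨D', hD'0, hD'⟩ := exists_abs_absZetaDeriv_sub_le 0
  refine Asymptotics.IsBigO.of_bound ((|E| + D') * 2 ^ ε) ?_
  rw [Metric.hasBasis_cobounded_compl_closedBall (0 : ℝ) |>.eventually_iff]
  refine ⟨1, trivial, fun t ht => ?_⟩
  have ht1 : 1 ≤ |t| := by
    have : 1 < |t| := by simpa using ht
    exact this.le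
  rw [Real.norm_of_nonneg (by positivity)]
  have h1 := (abs_le.1 (hD' t)).2
  simp only [absZetaDeriv] at h1
  rw [iteratedDeriv_zero] at h1
  have h2 := hE t
  have h3 : (1 + |t|) ^ ε ≤ 2 ^ ε * |t| ^ ε := by
    rw [← Real.mul_rpow (by norm_num) (by positivity)]
    exact Real.rpow_le_rpow (by positivity) (by linarith) hε.le
  calc ‖riemannZeta (1 / 2 + Complex.I * t)‖ ≤ (|E| + D') * (1 + |t|) ^ ε := by
        nlinarith [hone t, le_abs_self E]
    _ ≤ (|E| + D') * (2 ^ ε * |t| ^ ε) := by gcongr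
    _ = _ := by ring

/-! ### Mean ergodic theorem for the doubling map along a sequence -/

/-- A value occupies a single residue class modulo `m`, of asymptotic frequency `1/m < ε`.
Uniformity in `v` holds because there are only `m` classes. -/
theorem UniformlyDistributedOnInt.eventually_card_le {κ : ℕ → ℕ}
    (h : UniformlyDistributedOnInt κ) {ε : ℝ} (hε : 0 < ε) :
    ∀ᶠ N : ℕ in atTop, ∀ v : ℕ,
      (((Finset.range N).filter fun n => κ n = v).card : ℝ) ≤ ε * N := by
  obtain ⟨m, hm⟩ := exists_nat_gt (max 1 (1 / ε))
  have hm1 : 1 < m := by exact_mod_cast (le_max_left _ _).trans_lt hm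
  have hm0 : (0 : ℝ) < m := by positivity
  have hmε : 1 / (m : ℝ) < ε := by
    have := (le_max_right _ _).trans_lt hm
    rw [div_lt_iff₀ hε] at this
    rw [div_lt_iff₀ hm0]
    linarith
  have hall : ∀ᶠ N : ℕ in atTop, ∀ r ∈ Finset.range m,
      (((Finset.range N).filter fun n => κ n ≡ r [MOD m]).card : ℝ) / N < ε := by
    rw [Finset.eventually_all]
    intro r _
    exact (h m hm1 r).eventually_lt_const hmε
  filter_upwards [hall, eventually_gt_atTop 0] with N hN hN0 v
  have hN0 : (0 : ℝ) < N := by exact_mod_cast hN0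
  have h1 := hN (v % m) (Finset.mem_range.2 (Nat.mod_lt _ (by omega)))
  rw [div_lt_iff₀ hN0] at h1
  refine le_trans ?_ h1.le
  norm_cast
  apply Finset.card_le_card
  intro n hn
  simp only [Finset.mem_filter] at hn ⊢
  refine ⟨hn.1, ?_⟩
  rw [hn.2]
  exact (Nat.mod_modEq v m).symm

/-- On expanding the square only pairs of indices with equal `κ` survive, and each index has at most
`c` such partners. -/
theorem norm_sum_sq_le_of_orthonormal {E ι : Type*} [NormedAddCommGroup E]
    [InnerProductSpace ℂ E] {v : ι → E} (hv : Orthonormal ℂ v) (κ : ℕ → ℕ) {φ : ℕ → ι}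
    (hφ : Function.Injective φ) {N : ℕ} {c : ℝ}
    (hc : ∀ a, (((Finset.range N).filter fun n => κ n = a).card : ℝ) ≤ c) :
    ‖∑ n ∈ Finset.range N, v (φ (κ n))‖ ^ 2 ≤ N * c := by
  classical
  rw [← inner_self_eq_norm_sq (𝕜 := ℂ), sum_inner, map_sum]
  calc ∑ n ∈ Finset.range N, RCLike.re (inner ℂ (v (φ (κ n)))
          (∑ j ∈ Finset.range N, v (φ (κ j))))
      = ∑ n ∈ Finset.range N,
          (((Finset.range N).filter fun j => κ j = κ n).card : ℝ) := by
        refine Finset.sum_congr rfl fun n _ => ?_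
        rw [inner_sum, map_sum, Finset.card_filter]
        push_cast
        refine Finset.sum_congr rfl fun j _ => ?_
        rw [orthonormal_iff_ite.1 hv]
        by_cases hj : κ j = κ n
        · simp [hj]
        · have : φ (κ n) ≠ φ (κ j) := fun he => hj (hφ he).symm
          simp [hj, this]
    _ ≤ ∑ _n ∈ Finset.range N, c := Finset.sum_le_sum fun n _ => hc _
    _ = N * c := by simp

/-- If the averages of contractions converge to a bounded operator on a set of vectors with dense
span, they converge everywhere. -/
theorem tendsto_average_of_span_dense {E : Type*} [NormedAddCommGroup E] [NormedSpace ℂ E]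
    {A : ℕ → E →L[ℂ] E} (hA : ∀ n, ‖A n‖ ≤ 1) {P : E →L[ℂ] E} {s : Set E}
    (hs : (Submodule.span ℂ s).topologicalClosure = ⊤)
    (h : ∀ x ∈ s, Tendsto (fun n => A n x) atTop (𝓝 (P x))) (x : E) :
    Tendsto (fun n => A n x) atTop (𝓝 (P x)) := by
  have hspan : ∀ y ∈ Submodule.span ℂ s, Tendsto (fun n => A n y) atTop (𝓝 (P y)) := by
    intro y hy
    induction hy using Submodule.span_induction with
    | mem y hy => exact h y hy
    | zero => simp
    | add y z _ _ h1 h2 => simpa using h1.add h2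
    | smul c y _ h1 => simpa using h1.const_smul c
  have hx : x ∈ closure (Submodule.span ℂ s : Set E) := by
    rw [← Submodule.topologicalClosure_coe, hs]; trivial
  rw [Metric.tendsto_nhds]
  intro ε hε
  set δ := ε / (2 + ‖P‖) with hδ
  have hP : 0 < 2 + ‖P‖ := by positivity
  have hδ0 : 0 < δ := by positivity
  obtain ⟨y, hy, hxy⟩ := Metric.mem_closure_iff.1 hx δ hδ0
  filter_upwards [Metric.tendsto_nhds.1 (hspan y hy) δ hδ0] with n hn
  have h1 : dist (A n x) (A n y) ≤ dist x y := by
    rw [dist_eq_norm, dist_eq_norm, ← map_sub]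
    exact ((A n).le_opNorm _).trans (mul_le_of_le_one_left (norm_nonneg _) (hA n))
  have h2 : dist (P y) (P x) ≤ ‖P‖ * dist x y := by
    rw [dist_comm x y, dist_eq_norm, dist_eq_norm, ← map_sub]
    exact P.le_opNorm _
  have h3 : ‖P‖ * dist x y ≤ ‖P‖ * δ := by gcongr
  calc dist (A n x) (P x) ≤ dist (A n x) (A n y) + dist (A n y) (P y) + dist (P y) (P x) :=
        dist_triangle4 _ _ _ _
    _ < δ + δ + ‖P‖ * δ := by linarith
    _ = ε := by rw [hδ]; field_simp; ring

namespace UnitAddCircle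

theorem haarAddCircle_eq_volume :
    (AddCircle.haarAddCircle : Measure UnitAddCircle) = volume := by
  have h := AddCircle.volume_eq_smul_haarAddCircle (T := (1 : ℝ))
  rw [ENNReal.ofReal_one, one_smul] at h
  exact h.symm

instance isProbabilityMeasure_volume : IsProbabilityMeasure (volume : Measure UnitAddCircle) :=
  haarAddCircle_eq_volume ▸ inferInstance

theorem measurePreserving_two_nsmul :
    MeasurePreserving (fun y : UnitAddCircle => 2 • y) volume volume :=
  (AddCircle.ergodic_nsmul (T := 1) (n := 2) (by norm_num)).toMeasurePreserving

theorem iterate_two_nsmul (n : ℕ) :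
    (fun y : UnitAddCircle => 2 • y)^[n] = fun y => 2 ^ n • y := by
  induction n with
  | zero => ext y; simp
  | succ n ih =>
    rw [Function.iterate_succ', ih]
    ext y
    simp [← mul_smul, pow_succ']

theorem measurePreserving_two_pow_nsmul (n : ℕ) :
    MeasurePreserving (fun y : UnitAddCircle => 2 ^ n • y) volume volume :=
  iterate_two_nsmul n ▸ measurePreserving_two_nsmul.iterate n

theorem measurePreserving_haar_two_pow_nsmul (n : ℕ) :
    MeasurePreserving (fun y : UnitAddCircle => 2 ^ n • y)
      AddCircle.haarAddCircle AddCircle.haarAddCircle := by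
  rw [haarAddCircle_eq_volume]
  exact measurePreserving_two_pow_nsmul n

/-- The Koopman operator of `y ↦ 2 ^ n • y` on `L²`. -/
noncomputable def koopman (n : ℕ) : Lp ℂ 2 (AddCircle.haarAddCircle : Measure UnitAddCircle) →ₗᵢ[ℂ]
    Lp ℂ 2 (AddCircle.haarAddCircle : Measure UnitAddCircle) :=
  Lp.compMeasurePreservingₗᵢ ℂ (fun y : UnitAddCircle => 2 ^ n • y)
    (measurePreserving_haar_two_pow_nsmul n)

theorem coeFn_koopman (n : ℕ) (F : Lp ℂ 2 (AddCircle.haarAddCircle : Measure UnitAddCircle)) :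
    koopman n F =ᵐ[AddCircle.haarAddCircle] fun y => F (2 ^ n • y) :=
  Lp.coeFn_compMeasurePreserving F (measurePreserving_haar_two_pow_nsmul n)

theorem koopman_fourierLp (n : ℕ) (m : ℤ) :
    koopman n (fourierLp 2 m) = fourierLp 2 (2 ^ n * m) := by
  apply Lp.ext
  have h1 := (measurePreserving_haar_two_pow_nsmul n).quasiMeasurePreserving.ae_eq_comp
    (coeFn_fourierLp (T := 1) 2 m)
  filter_upwards [coeFn_koopman n (fourierLp 2 m), h1, coeFn_fourierLp (T := 1) 2 (2 ^ n * m)]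
    with y h2 h3 h4
  rw [h2, h4]
  refine h3.trans ?_
  simp only [Function.comp, fourier_apply]
  congr 2
  rw [mul_comm, mul_smul, ← natCast_zsmul y (2 ^ n)]
  push_cast
  rfl

/-- The averages of the Koopman operators along a sequence. -/
noncomputable def koopmanAverage (κ : ℕ → ℕ) (N : ℕ) :
    Lp ℂ 2 (AddCircle.haarAddCircle : Measure UnitAddCircle) →L[ℂ]
      Lp ℂ 2 (AddCircle.haarAddCircle : Measure UnitAddCircle) :=
  (N : ℂ)⁻¹ • ∑ n ∈ Finset.range N, (koopman (κ n)).toContinuousLinearMap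

theorem koopmanAverage_apply (κ : ℕ → ℕ) (N : ℕ)
    (F : Lp ℂ 2 (AddCircle.haarAddCircle : Measure UnitAddCircle)) :
    koopmanAverage κ N F = (N : ℂ)⁻¹ • ∑ n ∈ Finset.range N, koopman (κ n) F := by
  simp [koopmanAverage]

theorem norm_koopmanAverage_le (κ : ℕ → ℕ) (N : ℕ) : ‖koopmanAverage κ N‖ ≤ 1 := by
  refine ContinuousLinearMap.opNorm_le_bound _ zero_le_one fun F => ?_
  rw [koopmanAverage_apply, norm_smul, norm_inv, Complex.norm_natCast, one_mul]
  have h : ‖∑ n ∈ Finset.range N, koopman (κ n) F‖ ≤ N * ‖F‖ := by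
    refine (norm_sum_le _ _).trans ?_
    simp
  rcases Nat.eq_zero_or_pos N with rfl | hN
  · simp
  · have hN : (0 : ℝ) < N := by exact_mod_cast hN
    rw [inv_mul_le_iff₀ hN]
    exact h

/-- For `m ≠ 0` the frequencies `2 ^ n * m` are distinct, so the images of the character are
orthonormal apart from repetitions in `κ`, and these are rare. -/
theorem tendsto_koopmanAverage_fourierLp {κ : ℕ → ℕ} (hκ : UniformlyDistributedOnInt κ) {m : ℤ}
    (hm : m ≠ 0) : Tendsto (fun N => koopmanAverage κ N (fourierLp 2 m)) atTop (𝓝 0) := by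
  rw [Metric.tendsto_nhds]
  intro ε hε
  filter_upwards [hκ.eventually_card_le (ε := ε ^ 2 / 2) (by positivity), eventually_gt_atTop 0]
    with N hN hN0
  have hN0 : (0 : ℝ) < N := by exact_mod_cast hN0
  rw [dist_zero_right, koopmanAverage_apply, norm_smul, norm_inv, Complex.norm_natCast]
  simp only [koopman_fourierLp]
  have h := norm_sum_sq_le_of_orthonormal (orthonormal_fourier (T := 1)) κ
    (φ := fun n => 2 ^ n * m)
    (fun a b hab => by
      have h2 : (2 : ℤ) ^ a = 2 ^ b := mul_right_cancel₀ hm hab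
      exact Int.pow_right_injective (a := 2) (by norm_num) h2) hN
  rw [inv_mul_lt_iff₀ hN0]
  refine lt_of_pow_lt_pow_left₀ 2 (by positivity) (h.trans_lt ?_)
  have : 0 < (N : ℝ) ^ 2 * ε ^ 2 := by positivity
  nlinarith

/-- Orthogonal projection of `L²` onto the constants. -/
noncomputable def meanProj : Lp ℂ 2 (AddCircle.haarAddCircle : Measure UnitAddCircle) →L[ℂ]
    Lp ℂ 2 (AddCircle.haarAddCircle : Measure UnitAddCircle) :=
  (innerSL ℂ (fourierLp 2 0)).smulRight (fourierLp 2 0)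

theorem tendsto_koopmanAverage {κ : ℕ → ℕ} (hκ : UniformlyDistributedOnInt κ)
    (F : Lp ℂ 2 (AddCircle.haarAddCircle : Measure UnitAddCircle)) :
    Tendsto (fun N => koopmanAverage κ N F) atTop (𝓝 (meanProj F)) := by
  refine tendsto_average_of_span_dense (norm_koopmanAverage_le κ)
    (span_fourierLp_closure_eq_top (by norm_num)) ?_ F
  rintro _ ⟨m, rfl⟩
  have hP : meanProj (fourierLp 2 m) = if (0 : ℤ) = m then fourierLp 2 0 else 0 := by
    simp only [meanProj, ContinuousLinearMap.smulRight_apply, innerSL_apply_apply,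
      orthonormal_iff_ite.1 (orthonormal_fourier (T := 1))]
    split_ifs <;> simp
  rw [hP]
  split_ifs with hm
  · subst hm
    refine tendsto_const_nhds.congr' ?_
    filter_upwards [eventually_gt_atTop 0] with N hN
    have hN : (N : ℂ) ≠ 0 := by exact_mod_cast hN.ne'
    rw [koopmanAverage_apply]
    simp only [koopman_fourierLp, mul_zero, Finset.sum_const, Finset.card_range]
    rw [← Nat.cast_smul_eq_nsmul ℂ, smul_smul, inv_mul_cancel₀ hN, one_smul]
  · exact tendsto_koopmanAverage_fourierLp hκ (Ne.symm hm)

theorem coeFn_meanProj {f : UnitAddCircle → ℂ}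
    (hf : MemLp f 2 (AddCircle.haarAddCircle : Measure UnitAddCircle)) :
    meanProj (hf.toLp f) =ᵐ[AddCircle.haarAddCircle] fun _ => ∫ y, f y := by
  have h1 : inner ℂ (fourierLp 2 0) (hf.toLp f) = ∫ y : UnitAddCircle, f y := by
    rw [← haarAddCircle_eq_volume, L2.inner_def]
    apply integral_congr_ae
    filter_upwards [coeFn_fourierLp (T := 1) 2 0, hf.coeFn_toLp] with y h2 h3
    rw [h2, h3, fourier_zero]
    simp
  have h2 : meanProj (hf.toLp f) = (∫ y : UnitAddCircle, f y) • fourierLp 2 0 := by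
    rw [← h1]
    simp [meanProj]
  rw [h2]
  filter_upwards [Lp.coeFn_smul (∫ y : UnitAddCircle, f y) (fourierLp (T := 1) 2 0),
    coeFn_fourierLp (T := 1) 2 0] with y h3 h4
  rw [h3, Pi.smul_apply, h4, fourier_zero, smul_eq_mul, mul_one]

theorem coeFn_koopmanAverage (κ : ℕ → ℕ) {f : UnitAddCircle → ℂ}
    (hf : MemLp f 2 (AddCircle.haarAddCircle : Measure UnitAddCircle)) (N : ℕ) :
    koopmanAverage κ N (hf.toLp f) =ᵐ[AddCircle.haarAddCircle]
      fun y => (∑ n ∈ Finset.range N, f (2 ^ κ n • y)) / (N : ℂ) := by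
  rw [koopmanAverage_apply]
  have h1 : ∀ n, koopman (κ n) (hf.toLp f) =ᵐ[AddCircle.haarAddCircle]
      fun y => f (2 ^ κ n • y) := fun n =>
    (coeFn_koopman _ _).trans
      ((measurePreserving_haar_two_pow_nsmul (κ n)).quasiMeasurePreserving.ae_eq_comp
        hf.coeFn_toLp)
  filter_upwards [Lp.coeFn_smul (N : ℂ)⁻¹ (∑ n ∈ Finset.range N, koopman (κ n) (hf.toLp f)),
    Lp.coeFn_finsetSum (Finset.range N) (fun n => koopman (κ n) (hf.toLp f)), ae_all_iff.2 h1]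
    with y h2 h3 h4
  rw [h2, Pi.smul_apply, h3, Finset.sum_apply, smul_eq_mul, div_eq_inv_mul]
  congr 1
  exact Finset.sum_congr rfl fun n _ => h4 n

/-- Along a good universal sequence which is uniformly distributed on the integers, the averages
over the doubling map of the circle converge to the mean. -/
theorem ae_tendsto_average {κ : ℕ → ℕ} {p : ℝ≥0∞} (hgood : IsLpGoodUniversal p κ)
    (hκ : UniformlyDistributedOnInt κ) {f : UnitAddCircle → ℂ} (hf : MemLp f 2 volume)
    (hfp : MemLp f p volume) :
    ∀ᵐ y : UnitAddCircle, Tendsto (fun N : ℕ => (∑ n ∈ Finset.range N, f (2 ^ κ n • y)) / (N : ℂ))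
      atTop (𝓝 (∫ y, f y)) := by
  have h1 := hgood UnitAddCircle volume (fun y => 2 • y) measurePreserving_two_nsmul f hfp
  simp only [iterate_two_nsmul] at h1
  have hf' : MemLp f 2 (AddCircle.haarAddCircle : Measure UnitAddCircle) := by
    rwa [haarAddCircle_eq_volume]
  -- Goodness gives some pointwise limit; a subsequence of the `L²`-convergent averages converges
  -- almost everywhere to the mean and thereby identifies it.
  obtain ⟨ns, hns, hlim⟩ :=
    (tendstoInMeasure_of_tendsto_Lp (tendsto_koopmanAverage hκ (hf'.toLp f))).exists_seq_tendsto_ae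
  have h2 := ae_all_iff.2 fun N => coeFn_koopmanAverage κ hf' N
  have h3 := coeFn_meanProj hf'
  rw [← haarAddCircle_eq_volume] at h1
  suffices key : ∀ᵐ y : UnitAddCircle ∂AddCircle.haarAddCircle,
      Tendsto (fun N : ℕ => (∑ n ∈ Finset.range N, f (2 ^ κ n • y)) / (N : ℂ))
        atTop (𝓝 (∫ y, f y)) by
    rwa [haarAddCircle_eq_volume] at key
  filter_upwards [h1, hlim, h2, h3] with y ⟨c, hc⟩ h4 h5 h6
  have h7 : Tendsto (fun i => (∑ n ∈ Finset.range (ns i), f (2 ^ κ n • y)) / (ns i : ℂ)) atTop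
      (𝓝 (∫ y, f y)) := by
    rw [h6] at h4
    refine h4.congr fun i => h5 (ns i)
  have := tendsto_nhds_unique (hc.comp hns.tendsto_atTop) h7
  rwa [this] at hc

end UnitAddCircle

/-! ### Decay of correlations and an upper bound for averages of singular functions -/

theorem lintegral_Ioc_scale (H : ℝ → ℝ≥0∞) {q : ℝ} (hq : 0 < q) (i : ℕ) :
    ∫⁻ y in Set.Ioc (i / q) ((i + 1) / q), H y =
      ∫⁻ u in Set.Ioc (0 : ℝ) 1, ENNReal.ofReal (1 / q) * H ((u + i) / q) := by
  have himg : (fun u : ℝ => (u + i) / q) '' Set.Ioc 0 1 = Set.Ioc (i / q) ((i + 1) / q) := by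
    ext y
    simp only [Set.mem_image, Set.mem_Ioc]
    constructor
    · rintro ⟨u, ⟨h0, h1⟩, rfl⟩
      exact ⟨by gcongr; linarith, (div_le_div_iff_of_pos_right hq).2 (by linarith)⟩
    · rintro ⟨h0, h1⟩
      rw [div_lt_iff₀ hq] at h0
      rw [le_div_iff₀ hq] at h1
      exact ⟨y * q - i, ⟨by linarith, by linarith⟩, by field_simp; ring⟩
  rw [← himg, lintegral_image_eq_lintegral_abs_deriv_mul measurableSet_Ioc
    (f := fun u : ℝ => (u + i) / q) (f' := fun _ => 1 / q)
    (fun x _ => (((hasDerivAt_id x).add_const (i : ℝ)).div_const q).hasDerivWithinAt)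
    (fun a _ b _ hab => by
      have hab : (a + i) / q = (b + i) / q := hab
      field_simp at hab
      linarith)]
  rw [abs_of_pos (by positivity)]

/-- The summands correspond to the inverse branches `u ↦ (u + i) / q` of multiplication by `q`. -/
theorem lintegral_Ioc_zero_one_eq_sum (H : ℝ → ℝ≥0∞) {q : ℕ} (hq : 0 < q) :
    ∫⁻ y in Set.Ioc (0 : ℝ) 1, H y = ∑ i ∈ Finset.range q,
      ∫⁻ u in Set.Ioc (0 : ℝ) 1, ENNReal.ofReal (1 / q) * H ((u + i) / q) := by
  have hq' : (0 : ℝ) < q := by exact_mod_cast hq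
  have h : ∀ n : ℕ, ∫⁻ y in Set.Ioc (0 : ℝ) (n / q), H y = ∑ i ∈ Finset.range n,
      ∫⁻ u in Set.Ioc (0 : ℝ) 1, ENNReal.ofReal (1 / q) * H ((u + i) / q) := by
    intro n
    induction n with
    | zero => simp
    | succ n ih =>
      rw [Finset.sum_range_succ, ← ih, ← lintegral_Ioc_scale H hq' n,
        ← lintegral_union measurableSet_Ioc, Set.Ioc_union_Ioc_eq_Ioc]
      · push_cast; rfl
      · positivity
      · gcongr; linarith
      · exact Set.Ioc_disjoint_Ioc_of_le le_rfl
  rw [← h q, div_self hq'.ne']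

/-- Decay of correlations for the multiplication by `q` on the circle, for decreasing functions. -/
theorem lintegral_mul_nsmul_le {F : ℝ → ℝ≥0∞} (hF : AntitoneOn F (Set.Ioc 0 1))
    {G : UnitAddCircle → ℝ≥0∞} (hG : Measurable G) {q : ℕ} (hq : 0 < q) :
    ∫⁻ y in Set.Ioc (0 : ℝ) 1, F y * G (q • (y : UnitAddCircle)) ≤
      (∫⁻ u in Set.Ioc (0 : ℝ) 1, ENNReal.ofReal (1 / q) * (F (u / q) * G u)) +
        (∫⁻ y in Set.Ioc (0 : ℝ) 1, F y) * ∫⁻ y in Set.Ioc (0 : ℝ) 1, G y := by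
  have hq' : (0 : ℝ) < q := by exact_mod_cast hq
  have hGq : ∀ (u : ℝ) (i : ℕ), G (q • (((u + i) / q : ℝ) : UnitAddCircle)) = G u := by
    intro u i
    congr 1
    rw [← AddCircle.coe_nsmul, nsmul_eq_mul, mul_div_cancel₀ _ hq'.ne', AddCircle.coe_add]
    have : ((i : ℝ) : UnitAddCircle) = 0 := by
      have h := AddCircle.coe_period (1 : ℝ)
      have h2 : ((i : ℝ) : UnitAddCircle) = i • ((1 : ℝ) : UnitAddCircle) := by
        rw [← AddCircle.coe_nsmul, nsmul_eq_mul, mul_one]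
      rw [h2, h, smul_zero]
    rw [this, add_zero]
  have hGm : Measurable fun u : ℝ => G u := hG.comp AddCircle.measurable_mk'
  rw [lintegral_Ioc_zero_one_eq_sum _ hq]
  simp only [hGq]
  -- The branch `i = 0`, where `F` may be singular, is split off and becomes the correlation term.
  obtain ⟨n, rfl⟩ : ∃ n, q = n + 1 := ⟨q - 1, by omega⟩
  rw [Finset.sum_range_succ', add_comm]
  simp only [Nat.cast_zero, add_zero]
  refine add_le_add le_rfl ?_
  rw [lintegral_Ioc_zero_one_eq_sum F hq, Finset.sum_mul, Finset.sum_range_succ]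
  -- On branch `i + 1` the decreasing `F` is at most its average over branch `i`. These averages sum
  -- to at most `∫ F`, the last branch being discarded.
  refine le_trans (Finset.sum_le_sum fun i hi => ?_) le_self_add
  have hin : i + 1 ≤ n := by simpa using hi
  rw [← lintegral_const_mul _ hGm]
  refine setLIntegral_mono' measurableSet_Ioc fun u hu => ?_
  rw [← mul_assoc]
  gcongr
  calc ENNReal.ofReal (1 / (n + 1 : ℕ)) * F ((u + (i + 1 : ℕ)) / (n + 1 : ℕ))
      = ∫⁻ _ in Set.Ioc (0 : ℝ) 1,
          ENNReal.ofReal (1 / (n + 1 : ℕ)) * F ((u + (i + 1 : ℕ)) / (n + 1 : ℕ)) := by simp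
    _ ≤ _ := by
      refine setLIntegral_mono' measurableSet_Ioc fun v hv => ?_
      gcongr
      have hi' : (i : ℝ) + 1 ≤ n := by exact_mod_cast hin
      have hi0 : (0 : ℝ) ≤ i := by positivity
      apply hF
      · refine ⟨div_pos (by linarith [hv.1]) hq', (div_le_one hq').2 ?_⟩
        push_cast
        linarith [hv.2]
      · refine ⟨div_pos (by push_cast; linarith [hu.1]) hq', (div_le_one hq').2 ?_⟩
        push_cast
        linarith [hu.2]
      · rw [div_le_div_iff_of_pos_right hq']
        push_cast
        linarith [hu.1, hv.2]

theorem lintegral_rpow_neg_half :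
    ∫⁻ u in Set.Ioc (0 : ℝ) 1, ENNReal.ofReal (u ^ (-1 / 2 : ℝ)) = 2 := by
  have hint : IntegrableOn (fun u : ℝ => u ^ (-1 / 2 : ℝ)) (Set.Ioc 0 1) := by
    rw [← intervalIntegrable_iff_integrableOn_Ioc_of_le zero_le_one]
    exact intervalIntegral.intervalIntegrable_rpow' (by norm_num)
  rw [← ofReal_integral_eq_lintegral_ofReal hint]
  · rw [← intervalIntegral.integral_of_le zero_le_one, integral_rpow (by norm_num)]
    norm_num
  · filter_upwards [ae_restrict_mem measurableSet_Ioc] with u hu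
    exact Real.rpow_nonneg hu.1.le _

/-- The integrand is at most `q^{-1} (u/q)^{-1/4} u^{-1/4} = q^{-3/4} u^{-1/2}`, and `u^{-1/2}` has
integral `2`. -/
theorem lintegral_correlation_le {f : ℝ → ℝ} (hf0 : ∀ u ∈ Set.Ioc (0 : ℝ) 1, 0 ≤ f u)
    (hf : ∀ u ∈ Set.Ioc (0 : ℝ) 1, f u ≤ u ^ (-1 / 4 : ℝ)) {q : ℕ} (hq : 0 < q) :
    ∫⁻ u in Set.Ioc (0 : ℝ) 1,
      ENNReal.ofReal (1 / q) * (ENNReal.ofReal (f (u / q)) * ENNReal.ofReal (f u)) ≤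
        ENNReal.ofReal (2 * (q : ℝ) ^ (-3 / 4 : ℝ)) := by
  have hq' : (0 : ℝ) < q := by exact_mod_cast hq
  have hq1 : (1 : ℝ) ≤ q := by exact_mod_cast hq
  calc _ ≤ ∫⁻ u in Set.Ioc (0 : ℝ) 1, ENNReal.ofReal ((q : ℝ) ^ (-3 / 4 : ℝ)) *
          ENNReal.ofReal (u ^ (-1 / 2 : ℝ)) := by
        refine setLIntegral_mono' measurableSet_Ioc fun u hu => ?_
        have hu' : u / q ∈ Set.Ioc (0 : ℝ) 1 :=
          ⟨div_pos hu.1 hq', (div_le_one hq').2 (hu.2.trans hq1)⟩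
        rw [← ENNReal.ofReal_mul (hf0 _ hu'), ← ENNReal.ofReal_mul (by positivity),
          ← ENNReal.ofReal_mul (by positivity)]
        apply ENNReal.ofReal_le_ofReal
        calc 1 / q * (f (u / q) * f u)
            ≤ 1 / q * ((u / q) ^ (-1 / 4 : ℝ) * u ^ (-1 / 4 : ℝ)) := by
              gcongr
              · exact hf0 u hu
              · exact Real.rpow_nonneg hu'.1.le _
              · exact hf _ hu'
              · exact hf u hu
          _ = (q : ℝ) ^ (-3 / 4 : ℝ) * u ^ (-1 / 2 : ℝ) := by
              rw [Real.div_rpow hu.1.le hq'.le, div_eq_mul_inv _ ((q : ℝ) ^ _),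
                ← Real.rpow_neg hq'.le, one_div, ← Real.rpow_neg_one (q : ℝ)]
              rw [show (q : ℝ) ^ (-1 : ℝ) * (u ^ (-1 / 4 : ℝ) * (q : ℝ) ^ (-(-1 / 4) : ℝ) *
                u ^ (-1 / 4 : ℝ)) = ((q : ℝ) ^ (-1 : ℝ) * (q : ℝ) ^ (-(-1 / 4) : ℝ)) *
                (u ^ (-1 / 4 : ℝ) * u ^ (-1 / 4 : ℝ)) by ring, ← Real.rpow_add hq',
                ← Real.rpow_add hu.1]
              norm_num
    _ = ENNReal.ofReal ((q : ℝ) ^ (-3 / 4 : ℝ)) * 2 := by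
        rw [lintegral_const_mul' _ _ ENNReal.ofReal_ne_top, lintegral_rpow_neg_half]
    _ = _ := by
        rw [ENNReal.ofReal_mul zero_le_two, mul_comm]
        simp

/-- By injectivity each distance from `a` occurs at most once on either side, so each side is
bounded by a full geometric series. -/
theorem sum_pow_dist_le {κ : ℕ → ℕ} (hκ : Function.Injective κ) {ρ : ℝ} (hρ0 : 0 ≤ ρ)
    (hρ1 : ρ < 1) (a N : ℕ) :
    ∑ n ∈ Finset.range N, ρ ^ Nat.dist a (κ n) ≤ 2 * (1 - ρ)⁻¹ := by
  have hsum := summable_geometric_of_lt_one hρ0 hρ1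
  have hle : ∀ (s : Finset ℕ) (φ : ℕ → ℕ), Set.InjOn φ s →
      ∑ n ∈ s, ρ ^ φ n ≤ (1 - ρ)⁻¹ := by
    intro s φ hφ
    rw [← tsum_geometric_of_lt_one hρ0 hρ1, ← Finset.sum_image (f := fun j => ρ ^ j) hφ]
    exact hsum.sum_le_tsum _ fun i _ => by positivity
  rw [← Finset.sum_filter_add_sum_filter_not _ (fun n => κ n ≤ a), two_mul]
  refine add_le_add (hle _ _ ?_) (hle _ _ ?_)
  · intro x hx y hy hxy
    simp only [Finset.coe_filter, Finset.mem_range, Set.mem_ofPred_eq] at hx hy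
    apply hκ
    simp only [Nat.dist] at hxy
    omega
  · intro x hx y hy hxy
    simp only [Finset.coe_filter, Finset.mem_range, Set.mem_ofPred_eq] at hx hy
    apply hκ
    simp only [Nat.dist] at hxy
    omega

/-- A sequence of nonnegative functions with common mean `m` whose partial sums have linearly
growing variance has averages which are eventually at most `2 m + ε`, almost everywhere. -/
theorem ae_eventually_average_le {Ω : Type*} [MeasurableSpace Ω] {μ : Measure Ω}
    [IsProbabilityMeasure μ] {f : ℕ → Ω → ℝ} (hf0 : ∀ n x, 0 ≤ f n x)
    (hf : ∀ n, MemLp (f n) 2 μ) {m K : ℝ} (hm : ∀ n, ∫ x, f n x ∂μ = m)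
    (hK : ∀ N : ℕ, ∫ x, (∑ n ∈ Finset.range N, f n x) ^ 2 ∂μ ≤ N ^ 2 * m ^ 2 + K * N) :
    ∀ᵐ x ∂μ, ∀ ε > 0, ∀ᶠ N : ℕ in atTop, (∑ n ∈ Finset.range N, f n x) / N ≤ 2 * m + ε := by
  set S : ℕ → Ω → ℝ := fun N x => ∑ n ∈ Finset.range N, f n x with hS
  have hS2 : ∀ N, MemLp (S N) 2 μ := fun N => memLp_finsetSum _ fun n _ => hf n
  have hSint : ∀ N, ∫ x, S N x ∂μ = N * m := by
    intro N
    rw [hS]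
    simp only
    rw [integral_finsetSum _ fun n _ => (hf n).integrable one_le_two]
    simp [hm]
  -- Linear variance makes the mean square deviation along `N = 2 ^ i` summable in `i`, hence the
  -- averages along powers of two converge to `m` almost everywhere.
  have hvar : ∀ i : ℕ, ∫⁻ x, ENNReal.ofReal ((S (2 ^ i) x / 2 ^ i - m) ^ 2) ∂μ ≤
      ENNReal.ofReal (K * (1 / 2) ^ i) := by
    intro i
    have hd : MemLp (fun x => S (2 ^ i) x / 2 ^ i - m) 2 μ :=
      ((hS2 (2 ^ i)).mul_const (2 ^ i)⁻¹).sub (memLp_const m)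
    rw [← ofReal_integral_eq_lintegral_ofReal hd.integrable_sq
      (ae_of_all _ fun x => sq_nonneg _)]
    apply ENNReal.ofReal_le_ofReal
    have e : ∀ x, (S (2 ^ i) x / 2 ^ i - m) ^ 2 =
        S (2 ^ i) x ^ 2 * (1 / (2 ^ i) ^ 2) - S (2 ^ i) x * (2 * m / 2 ^ i) + m ^ 2 := by
      intro x; field_simp; ring
    simp only [e]
    rw [integral_add, integral_sub, integral_mul_const, integral_mul_const, hSint]
    · have := hK (2 ^ i)
      have h2 : (0 : ℝ) < 2 ^ i := by positivity
      simp only [integral_const, probReal_univ, smul_eq_mul, one_mul]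
      push_cast at this ⊢
      calc _ ≤ ((2 ^ i) ^ 2 * m ^ 2 + K * 2 ^ i) * (1 / (2 ^ i) ^ 2) -
            2 ^ i * m * (2 * m / 2 ^ i) + m ^ 2 := by gcongr
        _ = K * (1 / 2) ^ i := by rw [one_div_pow]; field_simp; ring
    · exact (hS2 _).integrable_sq.mul_const _
    · exact ((hS2 _).integrable one_le_two).mul_const _
    · exact ((hS2 _).integrable_sq.mul_const _).sub
        (((hS2 _).integrable one_le_two).mul_const _)
    · exact integrable_const _
  have hmeas : ∀ i : ℕ,
      AEMeasurable (fun x => ENNReal.ofReal ((S (2 ^ i) x / 2 ^ i - m) ^ 2)) μ := fun i =>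
    ((((hS2 (2 ^ i)).aestronglyMeasurable.aemeasurable.div_const _).sub_const _).pow_const
      2).ennreal_ofReal
  have htsum : ∫⁻ x, ∑' i : ℕ, ENNReal.ofReal ((S (2 ^ i) x / 2 ^ i - m) ^ 2) ∂μ ≠ ∞ := by
    rw [lintegral_tsum hmeas]
    refine ne_top_of_le_ne_top ?_ (ENNReal.tsum_le_tsum hvar)
    have : Summable fun i : ℕ => |K| * (1 / 2 : ℝ) ^ i :=
      (summable_geometric_of_lt_one (by norm_num) (by norm_num)).mul_left _
    refine ne_top_of_le_ne_top this.tsum_ofReal_ne_top (ENNReal.tsum_le_tsum fun i => ?_)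
    apply ENNReal.ofReal_le_ofReal
    gcongr
    exact le_abs_self K
  filter_upwards [ae_lt_top' (AEMeasurable.tsum hmeas) htsum] with x hx ε hε
  have h1 := ENNReal.tendsto_atTop_zero_of_tsum_ne_top hx.ne
  have h2 : ∀ᶠ i : ℕ in atTop, S (2 ^ i) x / 2 ^ i ≤ m + ε / 2 := by
    filter_upwards [h1.eventually_lt_const (ENNReal.ofReal_pos.2 (show 0 < (ε / 2) ^ 2 by positivity))]
      with i hi
    rw [ENNReal.ofReal_lt_ofReal_iff (by positivity)] at hi
    linarith [(abs_lt_of_sq_lt_sq' hi (by positivity)).2]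
  obtain ⟨i₀, hi₀⟩ := eventually_atTop.1 h2
  filter_upwards [eventually_ge_atTop (2 ^ i₀), eventually_gt_atTop 0] with N hN hN0
  have hN0' : (0 : ℝ) < N := by exact_mod_cast hN0
  -- By nonnegativity the sum up to `N` is at most that up to the next power of two, which is at
  -- most `2N`; this is the source of the factor `2`.
  set i := Nat.log 2 N with hi
  have hi1 : i₀ ≤ i := (Nat.le_log_iff_pow_le (by norm_num) hN0.ne').2 hN
  have hi2 : 2 ^ i ≤ N := Nat.pow_log_le_self 2 hN0.ne'
  have hi3 : N ≤ 2 ^ (i + 1) := (Nat.lt_pow_succ_log_self (by norm_num) N).le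
  have h3 := hi₀ (i + 1) (by omega)
  rw [div_le_iff₀ (by positivity)] at h3
  have h4 : S N x ≤ S (2 ^ (i + 1)) x :=
    Finset.sum_le_sum_of_subset_of_nonneg (Finset.range_mono hi3) fun n _ _ => hf0 n x
  have hm0 : 0 ≤ m := by rw [← hm 0]; exact integral_nonneg (hf0 0)
  rw [div_le_iff₀ hN0']
  have h5 : (2 : ℝ) ^ (i + 1) ≤ 2 * N := by
    rw [pow_succ]
    have : (2 : ℝ) ^ i ≤ N := by exact_mod_cast hi2
    linarith
  calc S N x ≤ (m + ε / 2) * 2 ^ (i + 1) := h4.trans h3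
    _ ≤ (m + ε / 2) * (2 * N) := by gcongr
    _ = _ := by ring

namespace UnitAddCircle

/-- The representative in `(0, 1]` of a point of the unit circle. -/
noncomputable def repr (y : UnitAddCircle) : ℝ := AddCircle.equivIoc 1 0 y

theorem repr_coe {x : ℝ} (hx : x ∈ Set.Ioc (0 : ℝ) 1) : repr x = x := by
  rw [repr, AddCircle.equivIoc_coe_eq (by simpa using hx)]

theorem repr_mem (y : UnitAddCircle) : repr y ∈ Set.Ioc (0 : ℝ) 1 := by
  simpa [repr] using (AddCircle.equivIoc (1 : ℝ) 0 y).2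

theorem coe_repr (y : UnitAddCircle) : (repr y : UnitAddCircle) = y :=
  (AddCircle.equivIoc (1 : ℝ) 0).symm_apply_apply y

theorem measurable_repr : Measurable repr :=
  measurable_subtype_coe.comp (AddCircle.measurableEquivIoc (1 : ℝ) 0).measurable

theorem lintegral_eq (f : UnitAddCircle → ℝ≥0∞) :
    ∫⁻ y, f y = ∫⁻ a in Set.Ioc (0 : ℝ) 1, f a := by
  rw [← UnitAddCircle.lintegral_preimage 0, zero_add]

theorem memLp_two_comp_repr {F : ℝ → ℝ} (hFm : Measurable F)
    (hF0 : ∀ u ∈ Set.Ioc (0 : ℝ) 1, 0 ≤ F u)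
    (hF : ∀ u ∈ Set.Ioc (0 : ℝ) 1, F u ≤ u ^ (-1 / 4 : ℝ)) :
    MemLp (fun y => F (repr y)) 2 volume := by
  have hm : Measurable fun y : UnitAddCircle => F (repr y) := hFm.comp measurable_repr
  rw [memLp_two_iff_integrable_sq hm.aestronglyMeasurable]
  refine ⟨(hm.pow_const 2).aestronglyMeasurable, ?_⟩
  rw [hasFiniteIntegral_iff_ofReal (ae_of_all _ fun y => sq_nonneg _), lintegral_eq]
  refine lt_of_le_of_lt (b := 2) ?_ (by norm_num)
  rw [← lintegral_rpow_neg_half]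
  refine setLIntegral_mono' measurableSet_Ioc fun u hu => ENNReal.ofReal_le_ofReal ?_
  rw [repr_coe hu]
  calc F u ^ 2 ≤ (u ^ (-1 / 4 : ℝ)) ^ 2 := by gcongr; exacts [hF0 u hu, hF u hu]
    _ = u ^ (-1 / 2 : ℝ) := by
      rw [← Real.rpow_natCast, ← Real.rpow_mul hu.1.le]
      norm_num

theorem integral_mul_two_pow_nsmul_le {F : ℝ → ℝ} (hFm : Measurable F)
    (hFa : AntitoneOn F (Set.Ioc 0 1))
    (hF0 : ∀ u ∈ Set.Ioc (0 : ℝ) 1, 0 ≤ F u)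
    (hF : ∀ u ∈ Set.Ioc (0 : ℝ) 1, F u ≤ u ^ (-1 / 4 : ℝ)) (j : ℕ) :
    ∫ y, F (repr y) * F (repr (2 ^ j • y)) ≤
      (∫ y, F (repr y)) ^ 2 + 2 * ((2 : ℝ) ^ (-3 / 4 : ℝ)) ^ j := by
  have hm : Measurable fun y : UnitAddCircle => F (repr y) := hFm.comp measurable_repr
  have h2 := memLp_two_comp_repr hFm hF0 hF
  have h2' := h2.comp_measurePreserving (measurePreserving_two_pow_nsmul j)
  have hnn : ∀ y, 0 ≤ F (repr y) := fun y => hF0 _ (repr_mem y)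
  have hint : Integrable (fun y => F (repr y) * F (repr (2 ^ j • y))) := h2.integrable_mul h2'
  have hI : 0 ≤ ∫ y, F (repr y) := integral_nonneg hnn
  rw [← ENNReal.ofReal_le_ofReal_iff (by positivity),
    ofReal_integral_eq_lintegral_ofReal hint (ae_of_all _ fun y => mul_nonneg (hnn _) (hnn _)),
    lintegral_eq]
  have key := lintegral_mul_nsmul_le (F := fun u => ENNReal.ofReal (F u))
    (G := fun y => ENNReal.ofReal (F (repr y)))
    (fun a ha b hb hab => ENNReal.ofReal_le_ofReal (hFa ha hb hab)) hm.ennreal_ofReal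
    (q := 2 ^ j) (by positivity)
  have e1 : ∫⁻ a in Set.Ioc (0 : ℝ) 1,
      ENNReal.ofReal (F (repr a) * F (repr (2 ^ j • (a : UnitAddCircle)))) =
      ∫⁻ y in Set.Ioc (0 : ℝ) 1,
        ENNReal.ofReal (F y) * ENNReal.ofReal (F (repr (2 ^ j • (y : UnitAddCircle)))) := by
    refine setLIntegral_congr_fun measurableSet_Ioc fun u hu => ?_
    rw [ENNReal.ofReal_mul (hnn _), repr_coe hu]
  have e2 : ∫⁻ u in Set.Ioc (0 : ℝ) 1, ENNReal.ofReal (1 / (2 ^ j : ℕ)) *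
      (ENNReal.ofReal (F (u / (2 ^ j : ℕ))) * ENNReal.ofReal (F (repr u))) =
      ∫⁻ u in Set.Ioc (0 : ℝ) 1, ENNReal.ofReal (1 / (2 ^ j : ℕ)) *
      (ENNReal.ofReal (F (u / (2 ^ j : ℕ))) * ENNReal.ofReal (F u)) := by
    refine setLIntegral_congr_fun measurableSet_Ioc fun u hu => ?_
    simp only [repr_coe hu]
  have e3 : ∫⁻ y in Set.Ioc (0 : ℝ) 1, ENNReal.ofReal (F (repr y)) =
      ENNReal.ofReal (∫ y, F (repr y)) := by
    rw [ofReal_integral_eq_lintegral_ofReal (h2.integrable one_le_two) (ae_of_all _ hnn),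
      lintegral_eq]
  have e4 : ∫⁻ y in Set.Ioc (0 : ℝ) 1, ENNReal.ofReal (F y) =
      ENNReal.ofReal (∫ y, F (repr y)) := by
    rw [← e3]
    refine setLIntegral_congr_fun measurableSet_Ioc fun u hu => ?_
    simp only [repr_coe hu]
  rw [e1]
  refine key.trans ?_
  rw [e2, e3, e4, ← ENNReal.ofReal_mul hI, ← sq, add_comm, ENNReal.ofReal_add (by positivity)
    (by positivity)]
  gcongr
  refine (lintegral_correlation_le hF0 hF (by positivity)).trans_eq ?_
  congr 2
  push_cast
  rw [← Real.rpow_natCast, ← Real.rpow_natCast, ← Real.rpow_mul zero_le_two,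
    ← Real.rpow_mul zero_le_two, mul_comm]

/-- Averages along distinct iterates of the doubling map of a decreasing function with a mild
singularity at the origin are asymptotically bounded by twice its mean. -/
theorem ae_eventually_average_comp_repr_le {κ : ℕ → ℕ} (hκ : Function.Injective κ)
    {F : ℝ → ℝ} (hFm : Measurable F) (hFa : AntitoneOn F (Set.Ioc 0 1))
    (hF0 : ∀ u ∈ Set.Ioc (0 : ℝ) 1, 0 ≤ F u)
    (hF : ∀ u ∈ Set.Ioc (0 : ℝ) 1, F u ≤ u ^ (-1 / 4 : ℝ)) :
    ∀ᵐ y : UnitAddCircle, ∀ ε > 0, ∀ᶠ N : ℕ in atTop,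
      (∑ n ∈ Finset.range N, F (repr (2 ^ κ n • y))) / N ≤ 2 * (∫ y, F (repr y)) + ε := by
  have hm : Measurable fun y : UnitAddCircle => F (repr y) := hFm.comp measurable_repr
  have h2 := memLp_two_comp_repr hFm hF0 hF
  have hmem : ∀ n, MemLp (fun y => F (repr (2 ^ n • y))) 2 volume := fun n =>
    h2.comp_measurePreserving (measurePreserving_two_pow_nsmul n)
  have hcomp : ∀ (n : ℕ) {g : UnitAddCircle → ℝ}, AEStronglyMeasurable g →
      ∫ y, g (2 ^ n • y) = ∫ y, g y := by
    intro n g hg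
    have hp := measurePreserving_two_pow_nsmul n
    rw [← integral_map hp.measurable.aemeasurable (hp.map_eq.symm ▸ hg), hp.map_eq]
  set ρ : ℝ := (2 : ℝ) ^ (-3 / 4 : ℝ) with hρ
  have hρ0 : 0 ≤ ρ := by positivity
  have hρ1 : ρ < 1 := Real.rpow_lt_one_of_one_lt_of_neg (by norm_num) (by norm_num)
  set m := ∫ y, F (repr y) with hmdef
  -- Invariance of the measure reduces the correlation at times `a ≤ b` to that at times `0` and `b
  -- - a`.
  have hle : ∀ a b : ℕ, a ≤ b →
      ∫ y, F (repr (2 ^ a • y)) * F (repr (2 ^ b • y)) ≤ m ^ 2 + 2 * ρ ^ Nat.dist a b := by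
    intro a b hab
    have e : ∀ y : UnitAddCircle, F (repr (2 ^ a • y)) * F (repr (2 ^ b • y)) =
        (fun z => F (repr z) * F (repr (2 ^ (b - a) • z))) (2 ^ a • y) := by
      intro y
      simp only [smul_smul, ← pow_add, Nat.sub_add_cancel hab]
    simp only [e]
    rw [hcomp a (g := fun z => F (repr z) * F (repr (2 ^ (b - a) • z)))
      (h2.integrable_mul (hmem (b - a))).aestronglyMeasurable, Nat.dist_eq_sub_of_le hab]
    exact integral_mul_two_pow_nsmul_le hFm hFa hF0 hF _
  have hcorr : ∀ a b : ℕ,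
      ∫ y, F (repr (2 ^ a • y)) * F (repr (2 ^ b • y)) ≤ m ^ 2 + 2 * ρ ^ Nat.dist a b := by
    intro a b
    rcases le_total a b with h | h
    · exact hle a b h
    · rw [Nat.dist_comm]
      simp only [mul_comm (F (repr (2 ^ a • _)))]
      exact hle b a h
  refine ae_eventually_average_le (K := 4 * (1 - ρ)⁻¹) (fun n y => hF0 _ (repr_mem _))
    (fun n => hmem (κ n)) (fun n => hcomp (κ n) hm.aestronglyMeasurable) fun N => ?_
  have hint : ∀ i j : ℕ,
      Integrable fun y => F (repr (2 ^ κ i • y)) * F (repr (2 ^ κ j • y)) := fun i j =>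
    (hmem (κ i)).integrable_mul (hmem (κ j))
  calc ∫ y, (∑ n ∈ Finset.range N, F (repr (2 ^ κ n • y))) ^ 2
      = ∑ i ∈ Finset.range N, ∑ j ∈ Finset.range N,
          ∫ y, F (repr (2 ^ κ i • y)) * F (repr (2 ^ κ j • y)) := by
        simp only [sq, Finset.sum_mul_sum]
        rw [integral_finsetSum _ fun i _ => integrable_finsetSum _ fun j _ => hint i j]
        exact Finset.sum_congr rfl fun i _ => integral_finsetSum _ fun j _ => hint i j
    _ ≤ ∑ i ∈ Finset.range N, ∑ j ∈ Finset.range N,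
          (m ^ 2 + 2 * ρ ^ Nat.dist (κ i) (κ j)) :=
        Finset.sum_le_sum fun i _ => Finset.sum_le_sum fun j _ => hcorr _ _
    _ ≤ ∑ i ∈ Finset.range N, (N * m ^ 2 + 2 * (2 * (1 - ρ)⁻¹)) := by
        refine Finset.sum_le_sum fun i _ => ?_
        rw [Finset.sum_add_distrib, ← Finset.mul_sum, Finset.sum_const, Finset.card_range,
          nsmul_eq_mul]
        gcongr
        exact sum_pow_dist_le hκ hρ0 hρ1 _ _
    _ = _ := by
        rw [Finset.sum_const, Finset.card_range, nsmul_eq_mul]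
        ring

end UnitAddCircle

/-! ### Conjugation of the Boole map to the doubling map -/

namespace UnitAddCircle

/-- The coordinate on the circle conjugating the doubling map to the Boole transformation. -/
noncomputable def booleCoord (α β : ℝ) (y : UnitAddCircle) : ℝ :=
  β - α * (Real.cos (Real.pi * repr y) / Real.sin (Real.pi * repr y))

/-- The point of the circle with coordinate `x`. -/
noncomputable def boolePoint (α β x : ℝ) : ℝ := Real.arctan ((x - β) / α) / Real.pi + 1 / 2

theorem measurable_booleCoord (α β : ℝ) : Measurable (booleCoord α β) := by
  have := measurable_repr
  unfold booleCoord
  exact measurable_const.sub (measurable_const.mul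
    ((Real.measurable_cos.comp (measurable_const.mul this)).div
      (Real.measurable_sin.comp (measurable_const.mul this))))

theorem boolePoint_mem (α β x : ℝ) : boolePoint α β x ∈ Set.Ioo (0 : ℝ) 1 := by
  have h1 := Real.neg_pi_div_two_lt_arctan ((x - β) / α)
  have h2 := Real.arctan_lt_pi_div_two ((x - β) / α)
  have hpi := Real.pi_pos
  unfold boolePoint
  constructor
  · have : -(1 / 2) < Real.arctan ((x - β) / α) / Real.pi := by
      rw [lt_div_iff₀ hpi]; linarith
    linarith
  · have : Real.arctan ((x - β) / α) / Real.pi < 1 / 2 := by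
      rw [div_lt_iff₀ hpi]; linarith
    linarith

/-- The cotangent has period `π`, so any representative of the class may be used. -/
theorem cos_div_sin_repr_coe (x : ℝ) :
    Real.cos (Real.pi * repr x) / Real.sin (Real.pi * repr x) =
      Real.cos (Real.pi * x) / Real.sin (Real.pi * x) := by
  have h : ((repr x : ℝ) : UnitAddCircle) = x := coe_repr _
  rw [← sub_eq_zero, ← AddCircle.coe_sub, AddCircle.coe_eq_zero_iff] at h
  obtain ⟨n, hn⟩ := h
  have e : Real.pi * repr x = Real.pi * x + n * Real.pi := by
    rw [zsmul_eq_mul, mul_one] at hn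
    rw [hn]
    ring
  rw [e, Real.cos_add_int_mul_pi, Real.sin_add_int_mul_pi, mul_div_mul_left]
  exact zpow_ne_zero _ (by norm_num)

theorem booleCoord_boolePoint {α : ℝ} (hα : 0 < α) (β x : ℝ) :
    booleCoord α β (boolePoint α β x) = x := by
  have hpi := Real.pi_pos
  rw [booleCoord, cos_div_sin_repr_coe]
  have h : Real.pi * boolePoint α β x = Real.arctan ((x - β) / α) + Real.pi / 2 := by
    rw [boolePoint]; field_simp
  rw [h, Real.cos_add_pi_div_two, Real.sin_add_pi_div_two, neg_div, ← Real.tan_eq_sin_div_cos,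
    Real.tan_arctan]
  field_simp
  ring

theorem two_nsmul_eq_zero_of_sin {y : UnitAddCircle}
    (h : Real.sin (2 * (Real.pi * repr y)) = 0) : 2 • y = 0 := by
  obtain ⟨n, hn⟩ := Real.sin_eq_zero_iff.1 h
  have h2 : 2 * repr y = n := by
    have hpi := Real.pi_pos.ne'
    apply mul_right_cancel₀ hpi
    linarith
  rw [← coe_repr y, ← AddCircle.coe_nsmul, nsmul_eq_mul, Nat.cast_ofNat, h2]
  exact AddCircle.coe_eq_zero_iff 1 |>.2 ⟨n, by simp⟩

/-- This is `cot 2θ = (cot θ - tan θ) / 2` with `θ = π y`. The excluded points are the zeros of `sin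
θ` and `cos θ`, where default values intervene. -/
theorem booleMap_booleCoord {α : ℝ} (hα : 0 < α) (β : ℝ) {y : UnitAddCircle} (hy : 2 • y ≠ 0) :
    booleMap α β (booleCoord α β y) = booleCoord α β (2 • y) := by
  have hs2 : Real.sin (2 * (Real.pi * repr y)) ≠ 0 := fun h => hy (two_nsmul_eq_zero_of_sin h)
  have h2 : (2 • y : UnitAddCircle) = ((2 * repr y : ℝ) : UnitAddCircle) := by
    conv_lhs => rw [← coe_repr y]
    rw [← AddCircle.coe_nsmul, nsmul_eq_mul, Nat.cast_ofNat]
  have e2 : booleCoord α β (2 • y) = β - α * (Real.cos (2 * (Real.pi * repr y)) /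
      Real.sin (2 * (Real.pi * repr y))) := by
    rw [booleCoord, h2, cos_div_sin_repr_coe]
    ring_nf
  rw [e2, booleCoord]
  rw [Real.sin_two_mul] at hs2 ⊢
  rw [Real.cos_two_mul']
  have hs : Real.sin (Real.pi * repr y) ≠ 0 := fun h => hs2 (by rw [h]; ring)
  have hc : Real.cos (Real.pi * repr y) ≠ 0 := fun h => hs2 (by rw [h]; ring)
  set s := Real.sin (Real.pi * repr y)
  set c := Real.cos (Real.pi * repr y)
  have hne : α * (c / s) ≠ 0 := mul_ne_zero hα.ne' (div_ne_zero hc hs)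
  rw [booleMap, if_neg (by intro h; apply hne; linarith)]
  have : β - α * (c / s) - β = -(α * (c / s)) := by ring
  rw [this]
  field_simp
  ring

theorem iterate_booleMap_booleCoord {α : ℝ} (hα : 0 < α) (β : ℝ) {y : UnitAddCircle}
    (hy : ∀ n : ℕ, 2 ^ n • y ≠ 0) (n : ℕ) :
    (booleMap α β)^[n] (booleCoord α β y) = booleCoord α β (2 ^ n • y) := by
  induction n with
  | zero => simp
  | succ n ih =>
    have h : (2 ^ (n + 1) • y : UnitAddCircle) = 2 • (2 ^ n • y) := by
      rw [smul_smul, ← pow_succ']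
    rw [Function.iterate_succ_apply', ih, h]
    refine booleMap_booleCoord hα β fun h0 => hy (n + 1) ?_
    rw [h, h0]

theorem volume_singleton_zero : volume ({0} : Set UnitAddCircle) = 0 := by
  have h := AddCircle.volume_closedBall (T := 1) (x := 0) 0
  simpa using h

theorem ae_two_pow_nsmul_ne_zero : ∀ᵐ y : UnitAddCircle, ∀ n : ℕ, 2 ^ n • y ≠ 0 := by
  refine ae_all_iff.2 fun n => ?_
  have h0 : MeasurableSet ({0} : Set UnitAddCircle) := isClosed_singleton.measurableSet
  have h := (measurePreserving_two_pow_nsmul n).measure_preimage h0.nullMeasurableSet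
  rw [volume_singleton_zero] at h
  exact measure_eq_zero_iff_ae_notMem.1 h

theorem hasDerivAt_boolePoint {α : ℝ} (hα : 0 < α) (β x : ℝ) :
    HasDerivAt (boolePoint α β)
      (ProbabilityTheory.cauchyPDFReal β α.toNNReal x) x := by
  have h := ((((hasDerivAt_id x).sub_const β).div_const α).arctan.div_const Real.pi).add_const
    (1 / 2 : ℝ)
  refine h.congr_deriv ?_
  rw [ProbabilityTheory.cauchyPDFReal_def, Real.coe_toNNReal _ hα.le]
  have := Real.pi_pos
  simp only [id]
  field_simp
  ring

theorem injective_boolePoint {α : ℝ} (hα : 0 < α) (β : ℝ) :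
    Function.Injective (boolePoint α β) := fun a b h => by
  rw [← booleCoord_boolePoint hα β a, h, booleCoord_boolePoint hα β b]

theorem range_boolePoint {α : ℝ} (hα : 0 < α) (β : ℝ) :
    Set.range (boolePoint α β) = Set.Ioo 0 1 := by
  have hpi := Real.pi_pos
  apply Set.Subset.antisymm
  · rintro _ ⟨x, rfl⟩
    exact boolePoint_mem α β x
  · intro t ht
    refine ⟨β + α * Real.tan (Real.pi * (t - 1 / 2)), ?_⟩
    have : (β + α * Real.tan (Real.pi * (t - 1 / 2)) - β) / α =
        Real.tan (Real.pi * (t - 1 / 2)) := by field_simp; ring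
    rw [boolePoint, this, Real.arctan_tan]
    · field_simp; ring
    · nlinarith [ht.1]
    · nlinarith [ht.2]

theorem booleMeasure_eq {α : ℝ} (hα : 0 < α) (β : ℝ) :
    booleMeasure α β =
      volume.withDensity (ProbabilityTheory.cauchyPDF β α.toNNReal) :=
  ProbabilityTheory.cauchyMeasure_of_scale_ne_zero β (Real.toNNReal_pos.2 hα).ne'

/-- `boolePoint` is the distribution function of the Cauchy law, so it carries this law to the
uniform one. -/
theorem measurePreserving_boolePoint {α : ℝ} (hα : 0 < α) (β : ℝ) :
    MeasurePreserving (fun x => (boolePoint α β x : UnitAddCircle)) (booleMeasure α β) volume := by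
  have hm : Measurable fun x => (boolePoint α β x : UnitAddCircle) := by
    apply AddCircle.measurable_mk'.comp
    exact (continuous_iff_continuousAt.2
      fun x => (hasDerivAt_boolePoint hα β x).continuousAt).measurable
  refine ⟨hm, Measure.ext_of_lintegral _ fun f hf => ?_⟩
  have hd := lintegral_withDensity_eq_lintegral_mul volume
    (ProbabilityTheory.measurable_cauchyPDF β α.toNNReal) (hf.comp hm)
  simp only [Function.comp_def] at hd
  rw [lintegral_map hf hm, booleMeasure_eq hα, hd, lintegral_eq, ← setLIntegral_congr Ioo_ae_eq_Ioc, ← range_boolePoint hα β, ← Set.image_univ,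
    lintegral_image_eq_lintegral_abs_deriv_mul MeasurableSet.univ
      (fun x _ => (hasDerivAt_boolePoint hα β x).hasDerivWithinAt)
      (injective_boolePoint hα β).injOn, setLIntegral_univ]
  refine lintegral_congr fun x => ?_
  rw [abs_of_nonneg (ProbabilityTheory.cauchyPDF_pos β (Real.toNNReal_pos.2 hα).ne' x).le]
  rfl

theorem integrable_div_of_integrable_comp_booleCoord {α : ℝ} (hα : 0 < α) (β : ℝ) {g : ℝ → ℝ}
    (hg : Measurable g) (h : Integrable fun y => g (booleCoord α β y)) :
    Integrable (fun τ => g τ / (α ^ 2 + (τ - β) ^ 2)) ∧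
      ∫ y, g (booleCoord α β y) =
        α / Real.pi * ∫ τ, g τ / (α ^ 2 + (τ - β) ^ 2) := by
  have hφ := measurePreserving_boolePoint hα β
  have hpi := Real.pi_pos
  have hmeas : Measurable fun y => g (booleCoord α β y) := hg.comp (measurable_booleCoord α β)
  have h1 : Integrable g (booleMeasure α β) := by
    have := hφ.integrable_comp_of_integrable h
    simpa only [Function.comp_def, booleCoord_boolePoint hα] using this
  have h2 : ∫ y, g (booleCoord α β y) = ∫ x, g x ∂(booleMeasure α β) := by
    rw [← hφ.map_eq, integral_map hφ.measurable.aemeasurable hmeas.aestronglyMeasurable]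
    simp only [booleCoord_boolePoint hα]
  have hpdf : ∀ x, (ProbabilityTheory.cauchyPDF β α.toNNReal x).toReal • g x =
      α / Real.pi * (g x / (α ^ 2 + (x - β) ^ 2)) := by
    intro x
    rw [ProbabilityTheory.cauchyPDF, ENNReal.toReal_ofReal
      (ProbabilityTheory.cauchyPDF_pos β (Real.toNNReal_pos.2 hα).ne' x).le,
      ProbabilityTheory.cauchyPDFReal_def, Real.coe_toNNReal _ hα.le, smul_eq_mul]
    field_simp
    ring
  have hlt : ∀ᵐ x, ProbabilityTheory.cauchyPDF β α.toNNReal x < ∞ :=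
    ae_of_all _ fun x => ENNReal.ofReal_lt_top
  rw [booleMeasure_eq hα] at h1 h2
  rw [integrable_withDensity_iff_integrable_smul'
    (ProbabilityTheory.measurable_cauchyPDF _ _) hlt] at h1
  simp only [hpdf] at h1
  rw [integral_withDensity_eq_integral_toReal_smul
    (ProbabilityTheory.measurable_cauchyPDF _ _) hlt] at h2
  simp only [hpdf, integral_const_mul] at h2
  refine ⟨?_, h2⟩
  have := h1.const_mul (Real.pi / α)
  refine this.congr (ae_of_all _ fun x => ?_)
  field_simp

/-- The point excluded is `0`, whose representative in `(0, 1]` is `1`. -/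
theorem repr_neg {y : UnitAddCircle} (hy : repr y < 1) : repr (-y) = 1 - repr y := by
  have h := repr_mem y
  have e : -y = ((1 - repr y : ℝ) : UnitAddCircle) := by
    rw [AddCircle.coe_sub, AddCircle.coe_period, coe_repr, zero_sub]
  rw [e, repr_coe ⟨by linarith, by linarith [h.1]⟩]

/-- The cotangent has simple poles at both ends of the period, and Jordan's inequality `sin (π r) ≥
2r` on `[0, 1/2]` makes this quantitative. The two ends are kept as separate terms, each monotone in
its own representative, for the correlation argument. -/
theorem one_add_abs_booleCoord_rpow_le {α : ℝ} (hα : 0 < α) (β : ℝ) (y : UnitAddCircle) :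
    (1 + |booleCoord α β y|) ^ (1 / 4 : ℝ) ≤ (1 + |β| + α) ^ (1 / 4 : ℝ) *
      (repr y ^ (-1 / 4 : ℝ) + repr (-y) ^ (-1 / 4 : ℝ)) := by
  have hr := repr_mem y
  have hC : 0 < 1 + |β| + α := by positivity
  have key : ∀ r : ℝ, 0 < r → r ≤ 1 → 1 + |booleCoord α β y| ≤ (1 + |β| + α) * (1 / r) →
      (1 + |booleCoord α β y|) ^ (1 / 4 : ℝ) ≤
        (1 + |β| + α) ^ (1 / 4 : ℝ) * r ^ (-1 / 4 : ℝ) := by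
    intro r h0 h1 h
    calc _ ≤ ((1 + |β| + α) * (1 / r)) ^ (1 / 4 : ℝ) :=
          Real.rpow_le_rpow (by positivity) h (by norm_num)
      _ = _ := by
        rw [Real.mul_rpow hC.le (by positivity), one_div r, Real.inv_rpow h0.le,
          ← Real.rpow_neg h0.le, neg_div]
  have hn1 : 0 ≤ repr y ^ (-1 / 4 : ℝ) := Real.rpow_nonneg hr.1.le _
  have hn2 : 0 ≤ repr (-y) ^ (-1 / 4 : ℝ) := Real.rpow_nonneg (repr_mem _).1.le _
  have hn3 : 0 ≤ (1 + |β| + α) ^ (1 / 4 : ℝ) := by positivity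
  rcases hr.2.lt_or_eq with hlt | heq
  · have habs : ∀ r : ℝ, 0 < r → r ≤ 1 / 2 → r ≤ Real.sin (Real.pi * repr y) →
        1 + |booleCoord α β y| ≤ (1 + |β| + α) * (1 / r) := by
      intro r h0 h1 hs
      have hs0 : 0 < Real.sin (Real.pi * repr y) := h0.trans_le hs
      have hb : |booleCoord α β y| ≤ |β| + α * (1 / r) := by
        rw [booleCoord]
        refine (abs_sub _ _).trans ?_
        rw [abs_mul, abs_of_pos hα, abs_div, abs_of_pos hs0]
        gcongr
        exact Real.abs_cos_le_one _
      have h2 : 1 ≤ 1 / r := by rw [le_div_iff₀ h0]; linarith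
      nlinarith [abs_nonneg β]
    have hpi := Real.pi_pos
    rcases le_total (repr y) (1 / 2) with hh | hh
    · have hs := Real.mul_le_sin (x := Real.pi * repr y) (by have := hr.1; positivity)
        (by nlinarith)
      have e : 2 / Real.pi * (Real.pi * repr y) = 2 * repr y := by field_simp
      have := key (repr y) hr.1 hr.2 (habs _ hr.1 hh (by linarith [hr.1]))
      nlinarith
    · rw [repr_neg hlt]
      rw [repr_neg hlt] at hn2
      have hs := Real.mul_le_sin (x := Real.pi * (1 - repr y))
        (mul_nonneg hpi.le (by linarith)) (by nlinarith)
      have e : 2 / Real.pi * (Real.pi * (1 - repr y)) = 2 * (1 - repr y) := by field_simp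
      have e2 : Real.sin (Real.pi * (1 - repr y)) = Real.sin (Real.pi * repr y) := by
        rw [mul_sub, mul_one, Real.sin_pi_sub]
      have := key (1 - repr y) (by linarith) (by linarith [hr.1])
        (habs _ (by linarith) (by linarith) (by linarith))
      nlinarith
  -- At `repr y = 1` the sine vanishes and division by zero returns `0`.
  · have hb : booleCoord α β y = β := by
      rw [booleCoord, heq]; simp
    have := key 1 zero_lt_one le_rfl (by rw [hb]; linarith)
    rw [heq] at hn1 ⊢
    nlinarith

theorem integrable_repr_rpow : Integrable fun y : UnitAddCircle => repr y ^ (-1 / 4 : ℝ) :=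
  (memLp_two_comp_repr (F := fun u => u ^ (-1 / 4 : ℝ)) (by fun_prop)
    (fun u hu => Real.rpow_nonneg hu.1.le _) (fun _ _ => le_rfl)).integrable one_le_two

theorem measurePreserving_neg : MeasurePreserving (fun y : UnitAddCircle => -y) volume volume :=
  Measure.measurePreserving_neg _

theorem integrable_one_add_abs_booleCoord_rpow {α : ℝ} (hα : 0 < α) (β : ℝ) :
    Integrable fun y => (1 + |booleCoord α β y|) ^ (1 / 4 : ℝ) := by
  have h : Integrable fun y : UnitAddCircle => (1 + |β| + α) ^ (1 / 4 : ℝ) *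
      (repr y ^ (-1 / 4 : ℝ) + repr (-y) ^ (-1 / 4 : ℝ)) :=
    (integrable_repr_rpow.add
      (measurePreserving_neg.integrable_comp_of_integrable integrable_repr_rpow)).const_mul _
  refine h.mono' ?_ (ae_of_all _ fun y => ?_)
  · have := measurable_booleCoord α β
    exact (((measurable_const (a := (1 : ℝ))).add this.abs).pow_const _).aestronglyMeasurable
  · rw [Real.norm_of_nonneg (by positivity)]
    exact one_add_abs_booleCoord_rpow_le hα β y

/-- Functions of slow growth have finite moments of all orders. -/
theorem memLp_comp_booleCoord {α : ℝ} (hα : 0 < α) (β : ℝ) {g : ℝ → ℝ} (hg : Measurable g)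
    (hgrow : ∀ δ : ℝ, 0 < δ → ∃ C : ℝ, 0 ≤ C ∧ ∀ x, |g x| ≤ C * (1 + |x|) ^ δ)
    {p : ℝ≥0∞} (hp : 1 ≤ p) (hp' : p ≠ ∞) :
    MemLp (fun y => g (booleCoord α β y)) p volume := by
  have hm : Measurable fun y => g (booleCoord α β y) := hg.comp (measurable_booleCoord α β)
  have hp0 : p ≠ 0 := (zero_lt_one.trans_le hp).ne'
  rw [← integrable_norm_rpow_iff hm.aestronglyMeasurable hp0 hp']
  have hq : 0 < p.toReal := ENNReal.toReal_pos hp0 hp'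
  -- Raising to the power `p` leaves the exponent `1/4`, which is integrable.
  obtain ⟨C, hC0, hC⟩ := hgrow (1 / (4 * p.toReal)) (by positivity)
  refine ((integrable_one_add_abs_booleCoord_rpow hα β).const_mul (C ^ p.toReal)).mono'
    (hm.norm.pow_const _).aestronglyMeasurable (ae_of_all _ fun y => ?_)
  rw [Real.norm_of_nonneg (by positivity)]
  calc ‖g (booleCoord α β y)‖ ^ p.toReal
      ≤ (C * (1 + |booleCoord α β y|) ^ (1 / (4 * p.toReal))) ^ p.toReal :=
        Real.rpow_le_rpow (norm_nonneg _) (hC _) hq.le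
    _ = _ := by
        rw [Real.mul_rpow hC0 (by positivity), ← Real.rpow_mul (by positivity)]
        congr 2
        field_simp

end UnitAddCircle

/-! ### Pointwise convergence and the equivalence -/

namespace UnitAddCircle

theorem ae_tendsto_average_real {κ : ℕ → ℕ} {p : ℝ≥0∞} (hgood : IsLpGoodUniversal p κ)
    (hκ : UniformlyDistributedOnInt κ) {f : UnitAddCircle → ℝ} (hf : MemLp f 2 volume)
    (hfp : MemLp f p volume) :
    ∀ᵐ y : UnitAddCircle, Tendsto (fun N : ℕ => (∑ n ∈ Finset.range N, f (2 ^ κ n • y)) / (N : ℝ))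
      atTop (𝓝 (∫ y, f y)) := by
  filter_upwards [ae_tendsto_average hgood hκ (f := fun y => (f y : ℂ)) hf.ofReal hfp.ofReal]
    with y hy
  rw [integral_complex_ofReal] at hy
  refine ((Complex.continuous_re.tendsto _).comp hy).congr fun N => ?_
  simp only [Function.comp]
  rw [← Complex.ofReal_sum, ← Complex.ofReal_natCast, ← Complex.ofReal_div, Complex.ofReal_re]

/-- The part above height `M` of the singular function `u ^ (-1 / 4)`. -/
noncomputable def singularTail (M : ℕ) (u : ℝ) : ℝ := max (u ^ (-1 / 4 : ℝ) - M) 0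

theorem measurable_singularTail (M : ℕ) : Measurable (singularTail M) := by
  unfold singularTail
  fun_prop

theorem singularTail_nonneg (M : ℕ) (u : ℝ) : 0 ≤ singularTail M u := le_max_right _ _

theorem singularTail_le (M : ℕ) {u : ℝ} (hu : 0 ≤ u) : singularTail M u ≤ u ^ (-1 / 4 : ℝ) :=
  max_le (by linarith [(Nat.cast_nonneg M : (0 : ℝ) ≤ M)]) (Real.rpow_nonneg hu _)

theorem antitoneOn_singularTail (M : ℕ) : AntitoneOn (singularTail M) (Set.Ioc 0 1) := by
  intro a ha b _ hab
  refine max_le_max ?_ le_rfl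
  have := Real.rpow_le_rpow_of_nonpos ha.1 hab (show (-1 / 4 : ℝ) ≤ 0 by norm_num)
  linarith

theorem integrable_singularTail (M : ℕ) :
    Integrable fun y : UnitAddCircle => singularTail M (repr y) :=
  (memLp_two_comp_repr (measurable_singularTail M) (fun u _ => singularTail_nonneg M u)
    (fun _ hu => singularTail_le M hu.1.le)).integrable one_le_two

theorem tendsto_integral_singularTail :
    Tendsto (fun M : ℕ => ∫ y : UnitAddCircle, singularTail M (repr y)) atTop (𝓝 0) := by
  have h := tendsto_integral_of_dominated_convergence (μ := (volume : Measure UnitAddCircle))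
    (F := fun M y => singularTail M (repr y)) (f := fun _ => (0 : ℝ))
    (fun y => repr y ^ (-1 / 4 : ℝ))
    (fun M => (integrable_singularTail M).aestronglyMeasurable) integrable_repr_rpow
    (fun M => ae_of_all _ fun y => by
      rw [Real.norm_of_nonneg (singularTail_nonneg M _)]
      exact singularTail_le M (repr_mem y).1.le)
    (ae_of_all _ fun y => by
      obtain ⟨M₀, hM₀⟩ := exists_nat_ge (repr y ^ (-1 / 4 : ℝ))
      refine tendsto_const_nhds.congr' ?_
      filter_upwards [eventually_ge_atTop M₀] with M hM
      have : (M₀ : ℝ) ≤ M := by exact_mod_cast hM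
      exact (max_eq_right (by linarith)).symm)
  simpa using h

theorem ae_neg {P : UnitAddCircle → Prop} (hP : ∀ᵐ y, P y) : ∀ᵐ y, P (-y) :=
  measurePreserving_neg.quasiMeasurePreserving.ae hP

theorem integrable_comp_neg {f : UnitAddCircle → ℝ} (hf : Integrable f) :
    Integrable fun y => f (-y) :=
  measurePreserving_neg.integrable_comp_of_integrable hf

theorem integral_comp_neg (f : UnitAddCircle → ℝ) : ∫ y, f (-y) = ∫ y, f y :=
  integral_neg_eq_self f volume

/-- Reflection preserves the measure and commutes with doubling, so the singularity at the other end
obeys the same bound; the two factors `2` add up to `4`. -/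
theorem ae_eventually_average_singularTail_le {κ : ℕ → ℕ} (hκ : Function.Injective κ) :
    ∀ᵐ y : UnitAddCircle, ∀ M : ℕ, ∀ ε > 0, ∀ᶠ N : ℕ in atTop,
      (∑ n ∈ Finset.range N, (singularTail M (repr (2 ^ κ n • y)) +
        singularTail M (repr (-(2 ^ κ n • y))))) / N ≤
        4 * (∫ y, singularTail M (repr y)) + ε := by
  have h1 : ∀ M : ℕ, ∀ᵐ y : UnitAddCircle, ∀ ε > 0, ∀ᶠ N : ℕ in atTop,
      (∑ n ∈ Finset.range N, singularTail M (repr (2 ^ κ n • y))) / N ≤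
        2 * (∫ y, singularTail M (repr y)) + ε := fun M =>
    ae_eventually_average_comp_repr_le hκ (measurable_singularTail M) (antitoneOn_singularTail M)
      (fun u _ => singularTail_nonneg M u) (fun _ hu => singularTail_le M hu.1.le)
  have h2 : ∀ M : ℕ, ∀ᵐ y : UnitAddCircle, ∀ ε > 0, ∀ᶠ N : ℕ in atTop,
      (∑ n ∈ Finset.range N, singularTail M (repr (2 ^ κ n • (-y)))) / N ≤
        2 * (∫ y, singularTail M (repr y)) + ε := fun M => by
    have := ae_neg (h1 M)
    exact this
  filter_upwards [ae_all_iff.2 h1, ae_all_iff.2 h2] with y h3 h4 M ε hε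
  filter_upwards [h3 M (ε / 2) (by positivity), h4 M (ε / 2) (by positivity)] with N h5 h6
  simp only [smul_neg] at h6
  rw [Finset.sum_add_distrib, add_div]
  linarith

/-- Truncation: averages of a nonnegative function converge to its mean as soon as those of its
truncations do and the remainders are dominated by `singularTail`. -/
theorem ae_tendsto_average_of_truncation {κ : ℕ → ℕ} (hgood : IsLpGoodUniversal ∞ κ)
    (hκ : UniformlyDistributedOnInt κ) (hinj : Function.Injective κ) {f : UnitAddCircle → ℝ}
    (hfm : Measurable f) (hf0 : ∀ y, 0 ≤ f y) (hf : Integrable f) {C : ℝ} (hC : 0 < C)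
    (hfC : ∀ y, f y ≤ C * (repr y ^ (-1 / 4 : ℝ) + repr (-y) ^ (-1 / 4 : ℝ))) :
    ∀ᵐ y : UnitAddCircle, Tendsto (fun N : ℕ => (∑ n ∈ Finset.range N, f (2 ^ κ n • y)) / (N : ℝ))
      atTop (𝓝 (∫ y, f y)) := by
  set trunc : ℕ → UnitAddCircle → ℝ := fun M y => min (f y) (2 * C * M) with htrunc
  have htm : ∀ M, Measurable (trunc M) := fun M => hfm.min measurable_const
  have ht0 : ∀ M y, 0 ≤ trunc M y := fun M y => le_min (hf0 y) (by positivity)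
  have htop : ∀ M, MemLp (trunc M) ∞ volume := fun M =>
    memLp_top_of_bound (htm M).aestronglyMeasurable (2 * C * M) (ae_of_all _ fun y => by
      rw [Real.norm_of_nonneg (ht0 M y)]
      exact min_le_right _ _)
  have htint : ∀ M, Integrable (trunc M) := fun M => (htop M).integrable le_top
  have hconv : ∀ M, ∀ᵐ y : UnitAddCircle,
      Tendsto (fun N : ℕ => (∑ n ∈ Finset.range N, trunc M (2 ^ κ n • y)) / (N : ℝ))
        atTop (𝓝 (∫ y, trunc M y)) := fun M =>
    ae_tendsto_average_real hgood hκ ((htop M).mono_exponent le_top) (htop M)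
  set tail : ℕ → UnitAddCircle → ℝ := fun M y =>
    singularTail M (repr y) + singularTail M (repr (-y)) with htail
  -- Each of the two singular terms bounding `f` is at most its tail plus `M`, so the cutoff `2 * C
  -- * M` leaves only the tails.
  have hle : ∀ M y, f y ≤ trunc M y + C * tail M y := by
    intro M y
    have h1 : repr y ^ (-1 / 4 : ℝ) - M ≤ singularTail M (repr y) := le_max_left _ _
    have h2 : repr (-y) ^ (-1 / 4 : ℝ) - M ≤ singularTail M (repr (-y)) := le_max_left _ _
    have h3 : 0 ≤ tail M y := add_nonneg (singularTail_nonneg _ _) (singularTail_nonneg _ _)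
    rcases le_total (f y) (2 * C * M) with h | h
    · simp only [htrunc, min_eq_left h]
      nlinarith
    · simp only [htrunc, min_eq_right h]
      have h4 : repr y ^ (-1 / 4 : ℝ) + repr (-y) ^ (-1 / 4 : ℝ) ≤ tail M y + 2 * M := by
        simp only [htail]; linarith
      calc f y ≤ C * (tail M y + 2 * M) := (hfC y).trans (by gcongr)
        _ = _ := by ring
  set I : ℕ → ℝ := fun M => ∫ y : UnitAddCircle, singularTail M (repr y) with hI
  have hI0 : ∀ M, 0 ≤ I M := fun M => integral_nonneg fun y => singularTail_nonneg _ _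
  have htailint : ∀ M, Integrable fun y : UnitAddCircle => singularTail M (repr (-y)) := fun M =>
    integrable_comp_neg (f := fun y => singularTail M (repr y)) (integrable_singularTail M)
  have hint : ∀ M, ∫ y, f y ≤ (∫ y, trunc M y) + C * (2 * I M) := by
    intro M
    have hneg : ∫ y : UnitAddCircle, singularTail M (repr (-y)) = I M :=
      integral_comp_neg fun y => singularTail M (repr y)
    have htint' : Integrable (tail M) := (integrable_singularTail M).add (htailint M)
    have htail' : ∫ y, tail M y = 2 * I M := by
      rw [two_mul]
      nth_rw 2 [← hneg]
      exact integral_add (integrable_singularTail M) (htailint M)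
    rw [← htail', ← integral_const_mul, ← integral_add (htint M) (htint'.const_mul C)]
    exact integral_mono hf ((htint M).add (htint'.const_mul C)) (hle M)
  have hint' : ∀ M, ∫ y, trunc M y ≤ ∫ y, f y := fun M =>
    integral_mono (htint M) hf fun y => min_le_left _ _
  filter_upwards [ae_all_iff.2 hconv, ae_eventually_average_singularTail_le hinj] with y hy1 hy2
  rw [Metric.tendsto_nhds]
  intro ε hε
  -- Truncation costs at most `4 C I(M)` in the averages, up to `ε / 4`, and `2 C I(M)` in the mean;
  -- both are then below `ε / 2`.
  obtain ⟨M, hM⟩ := ((tendsto_integral_singularTail.const_mul (8 * C)).eventually_lt_const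
    (show 8 * C * 0 < ε by simpa using hε)).exists
  have hM : 8 * C * I M < ε := hM
  filter_upwards [Metric.tendsto_nhds.1 (hy1 M) (ε / 4) (by positivity),
    hy2 M (ε / (4 * C)) (by positivity), eventually_gt_atTop 0] with N h1 h2 hN
  have hN : (0 : ℝ) < N := by exact_mod_cast hN
  rw [Real.dist_eq, abs_lt] at h1 ⊢
  set A := (∑ n ∈ Finset.range N, f (2 ^ κ n • y)) / (N : ℝ)
  set B := (∑ n ∈ Finset.range N, trunc M (2 ^ κ n • y)) / (N : ℝ)
  have hBA : B ≤ A := by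
    refine div_le_div_of_nonneg_right (Finset.sum_le_sum fun n _ => min_le_left _ _) hN.le
  have hAB : A ≤ B + C * (4 * I M + ε / (4 * C)) := by
    calc A ≤ (∑ n ∈ Finset.range N, (trunc M (2 ^ κ n • y) + C * tail M (2 ^ κ n • y))) / N :=
          div_le_div_of_nonneg_right (Finset.sum_le_sum fun n _ => hle M _) hN.le
      _ = B + C * ((∑ n ∈ Finset.range N, tail M (2 ^ κ n • y)) / N) := by
          rw [Finset.sum_add_distrib, add_div, ← Finset.mul_sum, mul_div_assoc]
      _ ≤ _ := by gcongr
  have e : C * (4 * I M + ε / (4 * C)) = 4 * C * I M + ε / 4 := by field_simp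
  rw [e] at hAB
  have h3 := hint M
  have h4 := hint' M
  have h5 := mul_nonneg hC.le (hI0 M)
  constructor <;> linarith [h1.1, h1.2]

/-- Averages of a nonnegative function of slow growth along the orbit of a good universal sequence
converge to the mean. -/
theorem ae_tendsto_average_comp_booleCoord {p : ℝ≥0∞} (hp : 1 ≤ p) {κ : ℕ → ℕ}
    (hgood : IsLpGoodUniversal p κ) (hκ : UniformlyDistributedOnInt κ)
    (hinj : p = ∞ → Function.Injective κ) {α : ℝ} (hα : 0 < α) (β : ℝ) {g : ℝ → ℝ}
    (hg : Measurable g) (hg0 : ∀ x, 0 ≤ g x)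
    (hgrow : ∀ δ : ℝ, 0 < δ → ∃ C : ℝ, 0 ≤ C ∧ ∀ x, |g x| ≤ C * (1 + |x|) ^ δ) :
    ∀ᵐ y : UnitAddCircle,
      Tendsto (fun N : ℕ => (∑ n ∈ Finset.range N, g (booleCoord α β (2 ^ κ n • y))) / (N : ℝ))
        atTop (𝓝 (∫ y, g (booleCoord α β y))) := by
  have h2 := memLp_comp_booleCoord hα β hg hgrow (p := 2) one_le_two (by norm_num)
  by_cases htop : p = ∞
  · subst htop
    obtain ⟨C, hC0, hC⟩ := hgrow (1 / 4) (by norm_num)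
    refine ae_tendsto_average_of_truncation hgood hκ (hinj rfl)
      (f := fun y => g (booleCoord α β y)) (hg.comp (measurable_booleCoord α β))
      (fun y => hg0 _) (h2.integrable one_le_two)
      (C := (C + 1) * (1 + |β| + α) ^ (1 / 4 : ℝ)) (by positivity) fun y => ?_
    calc g (booleCoord α β y) ≤ (C + 1) * (1 + |booleCoord α β y|) ^ (1 / 4 : ℝ) := by
          refine (le_abs_self _).trans ((hC _).trans ?_)
          gcongr
          linarith
      _ ≤ (C + 1) * ((1 + |β| + α) ^ (1 / 4 : ℝ) *
            (repr y ^ (-1 / 4 : ℝ) + repr (-y) ^ (-1 / 4 : ℝ))) := by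
          gcongr
          exact one_add_abs_booleCoord_rpow_le hα β y
      _ = _ := by ring
  · exact ae_tendsto_average_real hgood hκ h2 (memLp_comp_booleCoord hα β hg hgrow hp htop)

end UnitAddCircle

/-- The convergence on the circle is pulled back along `boolePoint`, off the null set of points
whose orbit meets `0`. -/
theorem ae_tendsto_average_booleMap {p : ℝ≥0∞} (hp : 1 ≤ p) {κ : ℕ → ℕ}
    (hgood : IsLpGoodUniversal p κ) (hκ : UniformlyDistributedOnInt κ)
    (hinj : p = ∞ → Function.Injective κ) {α : ℝ} (hα : 0 < α) (β : ℝ) {g : ℝ → ℝ}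
    (hg : Measurable g) (hg0 : ∀ x, 0 ≤ g x)
    (hgrow : ∀ δ : ℝ, 0 < δ → ∃ C : ℝ, 0 ≤ C ∧ ∀ x, |g x| ≤ C * (1 + |x|) ^ δ) :
    Integrable (fun τ => g τ / (α ^ 2 + (τ - β) ^ 2)) ∧
      ∀ᵐ x ∂(booleMeasure α β),
        Tendsto (fun N : ℕ => 1 / (N : ℝ) * ∑ n ∈ Finset.range N, g ((booleMap α β)^[κ n] x))
          atTop (𝓝 (α / Real.pi * ∫ τ, g τ / (α ^ 2 + (τ - β) ^ 2))) := by
  have hint := (UnitAddCircle.memLp_comp_booleCoord hα β hg hgrow (p := 1) le_rfl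
    (by norm_num)).integrable le_rfl
  obtain ⟨h1, h2⟩ := UnitAddCircle.integrable_div_of_integrable_comp_booleCoord hα β hg hint
  refine ⟨h1, ?_⟩
  have hφ := UnitAddCircle.measurePreserving_boolePoint hα β
  filter_upwards [hφ.quasiMeasurePreserving.ae
      (UnitAddCircle.ae_tendsto_average_comp_booleCoord hp hgood hκ hinj hα β hg hg0 hgrow),
    hφ.quasiMeasurePreserving.ae UnitAddCircle.ae_two_pow_nsmul_ne_zero] with x hx1 hx2
  rw [h2] at hx1
  refine hx1.congr fun N => ?_
  rw [div_eq_inv_mul, one_div]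
  congr 1
  refine Finset.sum_congr rfl fun n _ => ?_
  rw [← UnitAddCircle.iterate_booleMap_booleCoord hα β hx2,
    UnitAddCircle.booleCoord_boolePoint hα]

theorem exists_absZetaDeriv_pow_le_of_lindelof (h : LindelofHypothesis) (k l : ℕ) {δ : ℝ}
    (hδ : 0 < δ) :
    ∃ C : ℝ, 0 ≤ C ∧ ∀ t, |absZetaDeriv k t ^ (2 * l)| ≤ C * (1 + |t|) ^ δ := by
  -- The denominator `2l + 1` is positive also for `l = 0`, and the `2l`-th power keeps the exponent
  -- at most `δ`.
  obtain ⟨C, hC0, hC⟩ := exists_absZetaDeriv_le_of_lindelof h k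
    (ε := δ / (2 * l + 1)) (by positivity)
  refine ⟨C ^ (2 * l), by positivity, fun t => ?_⟩
  rw [abs_of_nonneg (pow_nonneg (absZetaDeriv_nonneg k t) _)]
  calc absZetaDeriv k t ^ (2 * l) ≤ (C * (1 + |t|) ^ (δ / (2 * l + 1))) ^ (2 * l) :=
        pow_le_pow_left₀ (absZetaDeriv_nonneg k t) (hC t) _
    _ = C ^ (2 * l) * (1 + |t|) ^ (δ / (2 * l + 1) * (2 * l : ℕ)) := by
        rw [mul_pow, ← Real.rpow_natCast ((1 + |t|) ^ _), ← Real.rpow_mul (by positivity)]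
    _ ≤ C ^ (2 * l) * (1 + |t|) ^ δ := by
        gcongr
        · linarith [abs_nonneg t]
        · push_cast
          rw [div_mul_eq_mul_div, div_le_iff₀ (by positivity)]
          nlinarith

theorem theorem11 (p : ℝ≥0∞) (hp : 1 ≤ p) (κ : ℕ → ℕ)
    (hgood : IsLpGoodUniversal p κ) (hHartman : HartmanUniformlyDistributed κ)
    (hinj : p = ∞ → Function.Injective κ)
    (k : ℕ) (α β : ℝ) (hα : 0 < α) :
    (∀ l : ℕ, 1 ≤ l →
      Integrable (fun τ : ℝ => absZetaDeriv k τ ^ (2 * l) / (α ^ 2 + (τ - β) ^ 2)) ∧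
      ∀ᵐ x ∂(booleMeasure α β),
        Tendsto
          (fun N : ℕ =>
            1 / (N : ℝ) *
              ∑ n ∈ Finset.range N, absZetaDeriv k ((booleMap α β)^[κ n] x) ^ (2 * l))
          atTop
          (𝓝 (α / Real.pi *
            ∫ τ : ℝ, absZetaDeriv k τ ^ (2 * l) / (α ^ 2 + (τ - β) ^ 2)))) ↔
      LindelofHypothesis := by
  constructor
  · intro h
    exact lindelofHypothesis_of_integrable hα fun l hl => (h l hl).1
  · intro h l _
    exact ae_tendsto_average_booleMap hp hgood hHartman.1 hinj hα β
      (g := fun x => absZetaDeriv k x ^ (2 * l))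
      ((continuous_absZetaDeriv k).pow _).measurable
      (fun x => pow_nonneg (absZetaDeriv_nonneg k x) _)
      (fun δ hδ => exists_absZetaDeriv_pow_le_of_lindelof h k l hδ)
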